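/- Let $G$ be a connected 3-dimensional Lie group with Lie algebra $L$ of left-invariant vector fields, and let $(\Delta,\langle\cdot,\cdot\rangle)$ be a left-invariant contact sub-Riemannian structure on $G$: a left-invariant rank 2 subbundle $\Delta\subset TG$ with $\Delta+[\Delta,\Delta]=TG$ and a left-invariant inner product on $\Delta$. Let $f_1,f_2\in L$ be an orthonormal frame of $\Delta$ and $f_0\in L$, $\chi,\kappa\in\mathbb R$ be such that $$[f_2,f_1]=f_0,\qquad [f_1,f_0]=(\chi+\kappa)f_2,\qquad [f_2,f_0]=(\chi-\kappa)f_1$$ (these relations imply that $G$ is unimodular). On $T^*G$, with projection $\pi:T^*G\to G$, tautological form $s_\lambda=\lambda\circ\pi_*$ and canonical symplectic form $\sigma=ds$, let the Hamiltonian vector field $\vec a$ of a smooth function $a$ be the unique field with $\sigma_\lambda(\cdot,\vec a)=d_\lambda a$, and let $\{a,b\}=\sigma(\vec a,\vec b)$. For $\lambda\in T^*_qG$ put $h_i(\lambda)=\langle\lambda,f_i(q)\rangle$ and $g_i(\lambda)=\langle\lambda,e_i(q)\rangle$, where $e_i$ is the right-invariant field obtained from $f_i$ by the inversion $q\mapsto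 q^{-1}$ (so $e_i(\mathrm{Id})=-f_i(\mathrm{Id})$), $i=0,1,2$. Let $$H=\tfrac12(h_1^2+h_2^2),\qquad E=2h_0^2-2\chi(h_1^2-h_2^2).$$ Call functions functionally independent on a set if their differentials are linearly independent at every point of it, and functionally dependent if their differentials are linearly dependent at every point of $T^*G$. Then: (1) $H,E,g_0,g_1,g_2$ are integrals of the Hamiltonian vector field $\vec H$ (smooth and constant along its trajectories), and the only nonzero Poisson brackets among them are, up to antisymmetry, $$\{g_2,g_1\}=g_0,\qquad \{g_1,g_0\}=(\chi+\kappa)g_2,\qquad \{g_2,g_0\}=(\chi-\kappa)g_1,$$ that is, all of $\{H,E\}$, $\{H,g_i\}$, $\{E,g_i\}$ vanish. (2) These integrals are functionally dependent, since $$4\kappa H+E=2\bigl(g_0^2+(\kappa-\chi)g_1^2+(\kappa+\chi)g_2^2\bigr).$$ Both sides of this identity are Casimir functions: as functions $\xi\mapsto 2\kappa(\xi_1^2+\xi_2^2)+2\xi_0^2-2\chi(\xi_1^2-\xi_2^2)$ and $\xi\mapsto 2(\xi_0^2+(\kappa-\chi)\xi_1^2+(\kappa+\chi)\xi_2^2)$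 on $L^*$, $\xi_i=\langle\xi,f_i\rangle$, their Lie–Poisson brackets with all smooth functions vanish; and on $T^*G$ each side Poisson-commutes with all $h_i$ and $g_i$, $i=0,1,2$. (3) $\vec H$ is Liouville integrable: there are three smooth functions on $T^*G$, one of them $H$, pairwise in involution and functionally independent on an open dense subset of $T^*G$. Specifically, for $g=\alpha_0g_0+\alpha_1g_1+\alpha_2g_2$ the integrals $H,E,g$ are in involution and functionally independent on an open dense subset of $T^*G$ (3.1) for every $(\alpha_0,\alpha_1,\alpha_2)\in\mathbb R^3\setminus\{0\}$, if $\chi\ne0$; (3.2) for every $(\alpha_0,\alpha_1,\alpha_2)\in\mathbb R^3$ with $\alpha_1^2+\alpha_2^2\ne0$, if $\chi=0$. -/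

import Mathlib

open Set Bundle VectorField
open scoped Manifold ContDiff

noncomputable section

namespace SubRiem

/-! ### Exterior derivative of a 1-form on a manifold -/

section OneForms

variable {F : Type*} [NormedAddCommGroup F] [NormedSpace ℝ F]
  {K : Type*} [TopologicalSpace K] (J : ModelWithCorners ℝ F K)
  {M : Type*} [TopologicalSpace M] [ChartedSpace K M]

/-- The coordinate expression of a 1-form `β` in the preferred chart at `x`: its pullback under the
inverse chart, a 1-form on the model vector space. -/
def formInChart (β : (y : M) → TangentSpace J y →L[ℝ] ℝ) (x : M) : F → F →L[ℝ] ℝ := fun z =>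
  (β ((extChartAt J x).symm z)).comp
    (mfderivWithin 𝓘(ℝ, F) J (extChartAt J x).symm (range J) z)

/-- The exterior derivative `dβ` of a 1-form, at `x`, on the tangent vectors `v`, `w`. It is computed
in the preferred chart at `x` by the formula `dβ(v, w) = D_v β(w) - D_w β(v)`. -/
def extDerivOneForm (β : (y : M) → TangentSpace J y →L[ℝ] ℝ) (x : M)
    (v w : TangentSpace J x) : ℝ :=
  let D : F →L[ℝ] F →L[ℝ] ℝ := fderivWithin ℝ (formInChart J β x) (range J) (extChartAt J x x)
  let v' : F := mfderiv J 𝓘(ℝ, F) (extChartAt J x) x v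
  let w' : F := mfderiv J 𝓘(ℝ, F) (extChartAt J x) x w
  D v' w' - D w' v'

/-- The differential of a real function at a point, as a covector. -/
def diffAt (a : M → ℝ) (x : M) : TangentSpace J x →L[ℝ] ℝ := mfderiv J 𝓘(ℝ, ℝ) a x

/-- The functions `a i` are functionally independent on an open dense subset. -/
def FunctionallyIndependent {ι : Type*} (a : ι → M → ℝ) : Prop :=
  ∃ U : Set M, IsOpen U ∧ Dense U ∧ ∀ x ∈ U, LinearIndependent ℝ (fun i => diffAt J (a i) x)

/-- The functions `a i` are functionally dependent: their differentials are linearly dependent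
at every point. -/
def FunctionallyDependent {ι : Type*} (a : ι → M → ℝ) : Prop :=
  ∀ x, ¬ LinearIndependent ℝ (fun i => diffAt J (a i) x)

/-- A smooth function is an integral of a vector field if it is constant along each of its
trajectories, on any interval of definition. -/
def IsFirstIntegral (X : (x : M) → TangentSpace J x) (a : M → ℝ) : Prop :=
  ContMDiff J 𝓘(ℝ, ℝ) ∞ a ∧
    ∀ (γ : ℝ → M) (s : Set ℝ), s.OrdConnected → IsMIntegralCurveOn (I := J) γ X s →
      ∀ t ∈ s, ∀ t' ∈ s, a (γ t) = a (γ t')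

end OneForms

variable {E : Type*} [NormedAddCommGroup E] [NormedSpace ℝ E]

/-! ### The cotangent bundle and its canonical symplectic structure -/

section Cotangent

variable (E) (G : Type*) [TopologicalSpace G] [ChartedSpace E G]

/-- The cotangent bundle `T*G` of a manifold modelled on `E`. -/
abbrev Cotangent : Type _ :=
  TotalSpace (E →L[ℝ] ℝ) (fun q : G => TangentSpace 𝓘(ℝ, E) q →L[ℝ] Trivial G ℝ q)

/-- The model of the cotangent bundle as a manifold. -/
abbrev cotangentModel : ModelWithCorners ℝ (E × (E →L[ℝ] ℝ)) (ModelProd E (E →L[ℝ] ℝ)) :=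
  𝓘(ℝ, E).prod 𝓘(ℝ, E →L[ℝ] ℝ)

variable {E G}

/-- The pairing `⟨l, v⟩` of a covector `l ∈ T*_q G` with a vector `v ∈ T_q G`. -/
def pairing (l : Cotangent E G) (v : TangentSpace 𝓘(ℝ, E) l.proj) : ℝ := l.snd v

variable [IsManifold 𝓘(ℝ, E) 1 G]

/-- The tautological (Liouville) 1-form `s` on `T*G`: `s_l = l ∘ π_*`. -/
def liouvilleForm (l : Cotangent E G) : TangentSpace (cotangentModel E) l →L[ℝ] ℝ :=
  ContinuousLinearMap.comp (l.snd : TangentSpace 𝓘(ℝ, E) l.proj →L[ℝ] ℝ)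
    (mfderiv (cotangentModel E) 𝓘(ℝ, E) (fun m : Cotangent E G => m.proj) l)

/-- The canonical symplectic form `σ = ds` on `T*G`. -/
def symplecticForm (l : Cotangent E G) (v w : TangentSpace (cotangentModel E) l) : ℝ :=
  extDerivOneForm (cotangentModel E) liouvilleForm l v w

/-- `v` is the value at `l` of the Hamiltonian vector field of `a`: `σ_l(·, v) = d_l a`. -/
def IsHamiltonianVector (a : Cotangent E G → ℝ) (l : Cotangent E G)
    (v : TangentSpace (cotangentModel E) l) : Prop :=
  ∀ w, symplecticForm l w v = diffAt (cotangentModel E) a l w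

/-- The Hamiltonian vector field of `a`, given by `σ_l(·, v) = d_l a`. -/
def hamiltonianField (a : Cotangent E G → ℝ) (l : Cotangent E G) :
    TangentSpace (cotangentModel E) l :=
  Classical.epsilon (IsHamiltonianVector a l)

/-- The Poisson bracket `{a, b} = σ(a⃗, b⃗)`, the derivative of `b` along the Hamiltonian vector
field of `a`. -/
def poisson (a b : Cotangent E G → ℝ) (l : Cotangent E G) : ℝ :=
  symplecticForm l (hamiltonianField a l) (hamiltonianField b l)

/-- Functions on `T*G` pairwise in involution. -/
def InInvolution {ι : Type*} (a : ι → Cotangent E G → ℝ) : Prop :=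
  ∀ i j l, poisson (a i) (a j) l = 0

/-- Liouville integrability of the Hamiltonian vector field of `H` on the symplectic manifold `T*G`
of dimension `2 d`, `d = dim G`: there are `d` smooth functions in involution, the first of which
is `H`, functionally independent on an open dense set. -/
def LiouvilleIntegrable (H : Cotangent E G → ℝ) : Prop :=
  ∃ a : Fin (Module.finrank ℝ E) → Cotangent E G → ℝ,
    (∃ i, i.val = 0 ∧ a i = H) ∧
    (∀ i, ContMDiff (cotangentModel E) 𝓘(ℝ, ℝ) ∞ (a i)) ∧
    InInvolution a ∧
    FunctionallyIndependent (cotangentModel E) a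

end Cotangent

/-! ### Lie groups: invariant Hamiltonians, sub-Riemannian structures, Casimir functions -/

section Groups

variable {G : Type*} [TopologicalSpace G] [ChartedSpace E G] [Group G]

/-- The right-invariant vector field obtained from the left-invariant one with value `v` at the
identity by the inversion `q ↦ q⁻¹`. (Inversion being an involution, pulling back along it is the
same as pushing forward.) Its value at the identity is `-v`. -/
def rightField (v : GroupLieAlgebra 𝓘(ℝ, E) G) (q : G) : TangentSpace 𝓘(ℝ, E) q :=
  mpullback 𝓘(ℝ, E) 𝓘(ℝ, E) (fun x : G => x⁻¹) (mulInvariantVectorField v) q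

/-- The Hamiltonian `h(l) = ⟨l, f(q)⟩` of the left-invariant vector field `f`, `f(Id) = v`. -/
def leftHam (v : GroupLieAlgebra 𝓘(ℝ, E) G) (l : Cotangent E G) : ℝ :=
  pairing l (mulInvariantVectorField v l.proj)

/-- The Hamiltonian `g(l) = ⟨l, e(q)⟩` of the right-invariant vector field `e`, `e(Id) = -v`. -/
def rightHam (v : GroupLieAlgebra 𝓘(ℝ, E) G) (l : Cotangent E G) : ℝ :=
  pairing l (rightField v l.proj)

/-- The geodesic Hamiltonian `H = (h₁² + h₂²) / 2` of an orthonormal frame `f₁, f₂`. -/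
def geodesicHam (f : Fin 3 → GroupLieAlgebra 𝓘(ℝ, E) G) (l : Cotangent E G) : ℝ :=
  (leftHam (f 1) l ^ 2 + leftHam (f 2) l ^ 2) / 2

/-- The full energy of the pendulum, `E = c²/2 - 2 χ r² cos γ = 2 h₀² - 2 χ (h₁² - h₂²)`, where
`h₁ = r cos θ`, `h₂ = r sin θ`, `γ = 2 θ`, `c = -2 h₀`. -/
def pendulumEnergy (χ : ℝ) (f : Fin 3 → GroupLieAlgebra 𝓘(ℝ, E) G) (l : Cotangent E G) : ℝ :=
  2 * leftHam (f 0) l ^ 2 - 2 * χ * (leftHam (f 1) l ^ 2 - leftHam (f 2) l ^ 2)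

/-- The left-hand side `4 κ H + E` of the Casimir identity, a left-invariant function. -/
def casimirLeft (χ κ : ℝ) (f : Fin 3 → GroupLieAlgebra 𝓘(ℝ, E) G) (l : Cotangent E G) : ℝ :=
  4 * κ * geodesicHam f l + pendulumEnergy χ f l

/-- The right-hand side of the Casimir identity, a right-invariant function. -/
def casimirRight (χ κ : ℝ) (f : Fin 3 → GroupLieAlgebra 𝓘(ℝ, E) G) (l : Cotangent E G) : ℝ :=
  2 * (rightHam (f 0) l ^ 2 + (κ - χ) * rightHam (f 1) l ^ 2 + (κ + χ) * rightHam (f 2) l ^ 2)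

/-- The linear combination `α₀ g₀ + α₁ g₁ + α₂ g₂` of right-invariant Hamiltonians. -/
def rightCombination (α : Fin 3 → ℝ) (f : Fin 3 → GroupLieAlgebra 𝓘(ℝ, E) G)
    (l : Cotangent E G) : ℝ :=
  ∑ i, α i * rightHam (f i) l

variable (E G) in
/-- A left-invariant contact sub-Riemannian structure (a plane distribution `Δ` with an inner
product on it, both left-invariant, with `Δ + [Δ, Δ] = TG`), given by its values on the Lie algebra
of left-invariant vector fields. -/
structure ContactSR where
  /-- the distribution -/
  plane : Submodule ℝ (GroupLieAlgebra 𝓘(ℝ, E) G)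
  finrank_plane : Module.finrank ℝ plane = 2
  contact : plane ⊔ Submodule.span ℝ {z | ∃ x ∈ plane, ∃ y ∈ plane, ⁅x, y⁆ = z} = ⊤
  /-- the inner product -/
  metric : plane →ₗ[ℝ] plane →ₗ[ℝ] ℝ
  symm : ∀ x y, metric x y = metric y x
  posDef : ∀ x, x ≠ 0 → 0 < metric x x

/-- `x, y` is an orthonormal frame of the sub-Riemannian structure. -/
def ContactSR.IsOrthonormalFrame (S : ContactSR E G) (x y : GroupLieAlgebra 𝓘(ℝ, E) G) : Prop :=
  S.plane = Submodule.span ℝ {x, y} ∧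
    ∃ (hx : x ∈ S.plane) (hy : y ∈ S.plane),
      S.metric ⟨x, hx⟩ ⟨x, hx⟩ = 1 ∧ S.metric ⟨y, hy⟩ ⟨y, hy⟩ = 1 ∧ S.metric ⟨x, hx⟩ ⟨y, hy⟩ = 0

variable [FiniteDimensional ℝ E]

/-- The differential at `ξ ∈ L*` of a function on `L*`, viewed as an element of `L = L**`. -/
def dualGradient (a : (E →L[ℝ] ℝ) → ℝ) (ξ : E →L[ℝ] ℝ) : E :=
  (Module.evalEquiv ℝ E).symm
    ((fderiv ℝ a ξ).toLinearMap ∘ₗ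
      (LinearMap.toContinuousLinearMap : (E →ₗ[ℝ] ℝ) ≃ₗ[ℝ] (E →L[ℝ] ℝ)).toLinearMap)

theorem apply_dualGradient (a : (E →L[ℝ] ℝ) → ℝ) (ξ η : E →L[ℝ] ℝ) :
    η (dualGradient a ξ) = fderiv ℝ a ξ η := by
  have h := Module.apply_evalEquiv_symm_apply (R := ℝ) (M := E) η.toLinearMap
    ((fderiv ℝ a ξ).toLinearMap ∘ₗ
      (LinearMap.toContinuousLinearMap : (E →ₗ[ℝ] ℝ) ≃ₗ[ℝ] (E →L[ℝ] ℝ)).toLinearMap)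
  exact h

variable (G) in
/-- The Lie–Poisson bracket on `L*`: `{a, b}(ξ) = ⟨ξ, [d_ξ a, d_ξ b]⟩`. -/
def liePoisson (a b : (E →L[ℝ] ℝ) → ℝ) (ξ : E →L[ℝ] ℝ) : ℝ :=
  let x : GroupLieAlgebra 𝓘(ℝ, E) G := dualGradient (E := E) a ξ
  let y : GroupLieAlgebra 𝓘(ℝ, E) G := dualGradient (E := E) b ξ
  let z : GroupLieAlgebra 𝓘(ℝ, E) G := ⁅x, y⁆
  ξ z

variable (G) in
/-- Casimir functions on the dual `L*` of the Lie algebra `L = T_Id G` (whose underlying normed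
space is `E`): smooth functions whose Lie–Poisson bracket with every smooth function vanishes. -/
def IsCasimir (C : (E →L[ℝ] ℝ) → ℝ) : Prop :=
  ContDiff ℝ ∞ C ∧ ∀ a : (E →L[ℝ] ℝ) → ℝ, ContDiff ℝ ∞ a → ∀ ξ, liePoisson G C a ξ = 0

end Groups

end SubRiem

end

open SubRiem

/-!
Everything rests on two facts about a Lie group: the momentum function `⟨l, X⟩` of a vector field
`X` satisfies `{⟨l, X⟩, ⟨l, Y⟩} = ⟨l, [X, Y]⟩` (`poisson_fieldHam`), and left-invariant fields
commute with right-invariant ones (`mlieBracket_rightField_leftField`). The former is a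
computation in the charts of `T*G`, where the tautological form is `p dx`; the latter is the
symmetry of the second derivatives of the product `(x, y) ↦ x q⁻¹ y`. Consequently the left
momenta `h_i` and the right momenta `g_i` each have the structure constants of the Lie algebra and
Poisson-commute with each other, and quadratic forms in the `h_i`, such as `H` and `E`, commute
with all `g_i`.

The function `4κH + E` is the quadratic form `C = 2 (h₀² + (κ - χ) h₁² + (κ + χ) h₂²)` in the left
momenta. The structure constants give `⟨ξ, [d_ξ C, v]⟩ = 0` for all `v`
(`IsUnimodularFrame.sum_casimirCoeff_mul`), so `C` is a Casimir function and `{H, E} = 0`. The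
right momenta of a covector are its left momenta transformed by `-Ad(q⁻¹)`. Along right-invariant
fields this transformation changes by the adjoint action (`diffAt_apply_rightCoord`), hence the
value of `C` does not change, and as `G` is connected it is the same on left and right momenta
(`IsUnimodularFrame.quadHam_leftHam_eq`). This is the identity which makes the five integrals
dependent.

For the independence of `H`, `E` and a combination `g` of the `g_i`, a relation between the
differentials is tested on the Hamiltonian field of `h₂`, where only `dH` and `dE` survive and `4κ
dH + dE` does not, and then on vertical vectors, where it becomes a relation between the gradient
of `C` and the value of the right-invariant field of `g`
(`IsUnimodularFrame.linearIndependent_diffAt`). For a nonzero field, these two vectors are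
independent for generic covectors in every fibre, except possibly when `C` is a multiple of the
square of a linear function, that is `χ = κ = 0`. In that case the Lie algebra is the Heisenberg
algebra, and `g` has to be taken outside its centre.
-/

namespace SubRiem

open scoped Topology

/-! ### The cotangent bundle in a chart -/

section

variable {E : Type*} [NormedAddCommGroup E] [NormedSpace ℝ E]
  {G : Type*} [TopologicalSpace G] [ChartedSpace E G] [IsManifold 𝓘(ℝ, E) ∞ G]

/-- The chart of `T*G` at `l` sends a covector to its base point read in the chart of `G` and to the
covector pulled back to the model space along the trivialization of `TG`. -/
theorem extChartAt_cotangent_apply (l m : Cotangent E G) :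
    extChartAt (cotangentModel E) l m = (extChartAt 𝓘(ℝ, E) l.proj m.proj,
      (m.snd : E →L[ℝ] ℝ).comp
        ((trivializationAt E (TangentSpace 𝓘(ℝ, E)) l.proj).symmL ℝ m.proj)) := by
  change (extChartAt 𝓘(ℝ, E) l.proj m.proj,
    (trivializationAt (E →L[ℝ] ℝ) (fun q : G => TangentSpace 𝓘(ℝ, E) q →L[ℝ] Trivial G ℝ q)
      l.proj m).2) = _
  rw [hom_trivializationAt_apply]
  congr 1
  ext v
  simp [ContinuousLinearMap.inCoordinates]

theorem extChartAt_cotangent_target (l : Cotangent E G) :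
    (extChartAt (cotangentModel E) l).target =
      (extChartAt 𝓘(ℝ, E) l.proj).target ×ˢ univ := by
  rw [FiberBundle.extChartAt_target, hom_trivializationAt_baseSet]
  congr 1
  ext z
  simp
  intro h
  simpa using (chartAt E l.proj).map_target h

theorem extChartAt_cotangent_symm_proj (l : Cotangent E G) {z : E × (E →L[ℝ] ℝ)}
    (hz : z ∈ (extChartAt (cotangentModel E) l).target) :
    ((extChartAt (cotangentModel E) l).symm z).proj = (extChartAt 𝓘(ℝ, E) l.proj).symm z.1 := by
  have hm := (extChartAt (cotangentModel E) l).map_target hz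
  have h := (extChartAt (cotangentModel E) l).right_inv hz
  rw [extChartAt_cotangent_apply] at h
  have h1 := congrArg Prod.fst h
  rw [← h1]
  refine ((extChartAt 𝓘(ℝ, E) l.proj).left_inv ?_).symm
  rw [extChartAt_source] at hm ⊢
  simp only [FiberBundle.chartedSpace_chartAt, mfld_simps] at hm
  exact hm.1.1

theorem extChartAt_cotangent_symm_snd (l : Cotangent E G) {z : E × (E →L[ℝ] ℝ)}
    (hz : z ∈ (extChartAt (cotangentModel E) l).target) :
    (((extChartAt (cotangentModel E) l).symm z).snd : E →L[ℝ] ℝ) =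
      z.2.comp (mfderiv 𝓘(ℝ, E) 𝓘(ℝ, E) (extChartAt 𝓘(ℝ, E) l.proj)
        ((extChartAt (cotangentModel E) l).symm z).proj : E →L[ℝ] E) := by
  have hm := (extChartAt (cotangentModel E) l).map_target hz
  have h := (extChartAt (cotangentModel E) l).right_inv hz
  rw [extChartAt_cotangent_apply] at h
  set m := (extChartAt (cotangentModel E) l).symm z
  have hmp : m.proj ∈ (chartAt E l.proj).source := by
    rw [extChartAt_source] at hm
    simp only [FiberBundle.chartedSpace_chartAt, mfld_simps] at hm
    exact hm.1.1
  have h2 := congrArg Prod.snd h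
  rw [← TangentBundle.continuousLinearMapAt_trivializationAt hmp]
  have h3 : (m.snd : E →L[ℝ] ℝ).comp
      ((trivializationAt E (TangentSpace 𝓘(ℝ, E)) l.proj).symmL ℝ m.proj) = z.2 := h2
  rw [← h3]
  ext v
  have := (trivializationAt E (TangentSpace 𝓘(ℝ, E)) l.proj).symmL_continuousLinearMapAt (R := ℝ)
    (b := m.proj) (by simpa using hmp) v
  exact congrArg (m.snd : E →L[ℝ] ℝ) this.symm

theorem mem_extChartAt_cotangent_target {l : Cotangent E G} {z : E × (E →L[ℝ] ℝ)} :
    z ∈ (extChartAt (cotangentModel E) l).target ↔ z.1 ∈ (extChartAt 𝓘(ℝ, E) l.proj).target := by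
  rw [extChartAt_cotangent_target]; simp

theorem contMDiff_cotangent_proj :
    ContMDiff (cotangentModel E) 𝓘(ℝ, E) ∞ (fun m : Cotangent E G => m.proj) :=
  contMDiff_proj _

/-- In the chart, the Liouville form is the tautological form `p dx` of `E × E*`. -/
theorem formInChart_liouville (l : Cotangent E G) {z : E × (E →L[ℝ] ℝ)}
    (hz : z ∈ (extChartAt (cotangentModel E) l).target) :
    formInChart (cotangentModel E) liouvilleForm l z =
      z.2.comp (ContinuousLinearMap.fst ℝ E (E →L[ℝ] ℝ)) := by
  set χ := extChartAt (cotangentModel E) l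
  set φ := extChartAt 𝓘(ℝ, E) l.proj
  have hz1 : z.1 ∈ φ.target := mem_extChartAt_cotangent_target.1 hz
  have hχ : MDifferentiableAt 𝓘(ℝ, E × (E →L[ℝ] ℝ)) (cotangentModel E) χ.symm z := by
    have := mdifferentiableWithinAt_extChartAt_symm hz
    rwa [ModelWithCorners.range_eq_univ, mdifferentiableWithinAt_univ] at this
  have hφ : MDifferentiableAt 𝓘(ℝ, E) 𝓘(ℝ, E) φ.symm z.1 := by
    have := mdifferentiableWithinAt_extChartAt_symm hz1
    rwa [ModelWithCorners.range_eq_univ, mdifferentiableWithinAt_univ] at this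
  have hfst : MDifferentiableAt 𝓘(ℝ, E × (E →L[ℝ] ℝ)) 𝓘(ℝ, E) (Prod.fst : E × (E →L[ℝ] ℝ) → E) z :=
    (ContinuousLinearMap.fst ℝ E (E →L[ℝ] ℝ)).differentiableAt.mdifferentiableAt
  have h1 : mfderiv 𝓘(ℝ, E × (E →L[ℝ] ℝ)) 𝓘(ℝ, E) ((fun m : Cotangent E G => m.proj) ∘ χ.symm) z =
      mfderiv 𝓘(ℝ, E × (E →L[ℝ] ℝ)) 𝓘(ℝ, E) (φ.symm ∘ Prod.fst) z := by
    apply Filter.EventuallyEq.mfderiv_eq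
    filter_upwards [(isOpen_extChartAt_target l).mem_nhds hz] with y hy
    exact extChartAt_cotangent_symm_proj l hy
  rw [mfderiv_comp (I' := cotangentModel E) z
      (contMDiff_cotangent_proj.mdifferentiableAt (by simp)) hχ,
    mfderiv_comp (I' := 𝓘(ℝ, E)) z hφ hfst] at h1
  have h2 : (mfderiv 𝓘(ℝ, E) 𝓘(ℝ, E) φ (χ.symm z).proj : E →L[ℝ] E) ∘L
      (mfderiv 𝓘(ℝ, E) 𝓘(ℝ, E) φ.symm z.1 : E →L[ℝ] E) = ContinuousLinearMap.id ℝ E := by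
    have := mfderiv_extChartAt_comp_mfderivWithin_extChartAt_symm hz1
    rw [ModelWithCorners.range_eq_univ, mfderivWithin_univ,
      ← extChartAt_cotangent_symm_proj l hz] at this
    exact this
  have h3 : mfderiv 𝓘(ℝ, E × (E →L[ℝ] ℝ)) 𝓘(ℝ, E) (Prod.fst : E × (E →L[ℝ] ℝ) → E) z =
      ContinuousLinearMap.fst ℝ E (E →L[ℝ] ℝ) := by
    rw [mfderiv_eq_fderiv]; exact fderiv_fst
  have h4 := extChartAt_cotangent_symm_snd l hz
  unfold formInChart liouvilleForm
  rw [ModelWithCorners.range_eq_univ, mfderivWithin_univ]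
  refine ContinuousLinearMap.ext fun w => ?_
  rw [h3] at h1
  have h5 := congrArg (fun L : (E × (E →L[ℝ] ℝ)) →L[ℝ] E => L w) h1
  have h6 : ∀ v : E, ((χ.symm z).snd : E →L[ℝ] ℝ)
      ((mfderiv 𝓘(ℝ, E) 𝓘(ℝ, E) φ.symm z.1 : E →L[ℝ] E) v) = z.2 v := by
    intro v
    rw [h4]
    exact congrArg z.2 (DFunLike.congr_fun h2 v)
  refine (congrArg ((χ.symm z).snd : E →L[ℝ] ℝ) h5).trans (h6 _)

/-- With the sign convention `σ = ds`, the symplectic form on tangent vectors `(x, p)` of `T*G` at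
`l`, read in the preferred chart, is `p_v(x_w) - p_w(x_v)`. -/
theorem symplecticForm_apply (l : Cotangent E G) (v w : E × (E →L[ℝ] ℝ)) :
    symplecticForm l v w = v.2 w.1 - w.2 v.1 := by
  have hF : fderivWithin ℝ (formInChart (cotangentModel E) liouvilleForm l)
      (range (cotangentModel E)) (extChartAt (cotangentModel E) l l) =
      (ContinuousLinearMap.compL ℝ (E × (E →L[ℝ] ℝ)) E ℝ).flip
        (ContinuousLinearMap.fst ℝ E (E →L[ℝ] ℝ)) ∘L ContinuousLinearMap.snd ℝ E (E →L[ℝ] ℝ) := by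
    rw [ModelWithCorners.range_eq_univ, fderivWithin_univ,
      ← ContinuousLinearMap.fderiv ((ContinuousLinearMap.compL ℝ (E × (E →L[ℝ] ℝ)) E ℝ).flip
        (ContinuousLinearMap.fst ℝ E (E →L[ℝ] ℝ)) ∘L ContinuousLinearMap.snd ℝ E (E →L[ℝ] ℝ))
        (x := extChartAt (cotangentModel E) l l)]
    apply Filter.EventuallyEq.fderiv_eq
    filter_upwards [extChartAt_target_mem_nhds (I := cotangentModel E) l] with z hz
    exact formInChart_liouville l hz
  unfold symplecticForm extDerivOneForm
  rw [hF, mfderiv_extChartAt_self]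
  rfl

end

/-! ### Hamiltonian vector fields and Poisson brackets of momentum functions -/

section

variable {E : Type*} [NormedAddCommGroup E] [NormedSpace ℝ E]
  {G : Type*} [TopologicalSpace G] [ChartedSpace E G] [IsManifold 𝓘(ℝ, E) ∞ G]

/-- Nondegeneracy of the symplectic form of `E × E*`: every functional is represented by a vector.
-/
theorem exists_forall_sub_eq [FiniteDimensional ℝ E] (L : (E × (E →L[ℝ] ℝ)) →L[ℝ] ℝ) :
    ∃ v : E × (E →L[ℝ] ℝ), ∀ w : E × (E →L[ℝ] ℝ), w.2 v.1 - v.2 w.1 = L w := by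
  refine ⟨((Module.evalEquiv ℝ E).symm
    ((L ∘L ContinuousLinearMap.inr ℝ E (E →L[ℝ] ℝ)).toLinearMap ∘ₗ
      (LinearMap.toContinuousLinearMap : (E →ₗ[ℝ] ℝ) ≃ₗ[ℝ] (E →L[ℝ] ℝ)).toLinearMap),
    -(L ∘L ContinuousLinearMap.inl ℝ E (E →L[ℝ] ℝ))), fun w => ?_⟩
  have h := Module.apply_evalEquiv_symm_apply (R := ℝ) (M := E) w.2.toLinearMap
    ((L ∘L ContinuousLinearMap.inr ℝ E (E →L[ℝ] ℝ)).toLinearMap ∘ₗ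
      (LinearMap.toContinuousLinearMap : (E →ₗ[ℝ] ℝ) ≃ₗ[ℝ] (E →L[ℝ] ℝ)).toLinearMap)
  have h' : w.2.toLinearMap.toContinuousLinearMap = w.2 := by ext; rfl
  simp only [LinearMap.comp_apply, LinearEquiv.coe_coe, h'] at h
  have h2 : L w = L (0, w.2) + L (w.1, 0) := by rw [← map_add]; simp
  rw [h2]
  simp only [_root_.neg_apply, sub_neg_eq_add]
  exact congrArg₂ (· + ·) h rfl

theorem existsUnique_isHamiltonianVector [FiniteDimensional ℝ E] (a : Cotangent E G → ℝ)
    (l : Cotangent E G) : ∃! v, IsHamiltonianVector a l v := by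
  obtain ⟨v, hv⟩ := exists_forall_sub_eq
    (diffAt (cotangentModel E) a l : (E × (E →L[ℝ] ℝ)) →L[ℝ] ℝ)
  refine ⟨v, fun w => (symplecticForm_apply l w v).trans (hv w), fun u hu => ?_⟩
  have key : ∀ w : E × (E →L[ℝ] ℝ), w.2 (Prod.fst (α := E) (β := E →L[ℝ] ℝ) u) -
      (Prod.snd (α := E) (β := E →L[ℝ] ℝ) u) w.1 = w.2 v.1 - v.2 w.1 := fun w =>
    ((symplecticForm_apply l w u).symm.trans (hu w)).trans (hv w).symm
  refine Prod.ext ?_ ?_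
  · refine (SeparatingDual.eq_iff_forall_dual_eq (R := ℝ)).2 fun g => ?_
    simpa using key (0, g)
  · refine ContinuousLinearMap.ext fun x => ?_
    simpa using key (x, 0)

theorem isHamiltonianVector_hamiltonianField [FiniteDimensional ℝ E] (a : Cotangent E G → ℝ)
    (l : Cotangent E G) : IsHamiltonianVector a l (hamiltonianField a l) :=
  Classical.epsilon_spec (existsUnique_isHamiltonianVector a l).exists

/-- The bracket `{a, b}` is the derivative of `b` along the Hamiltonian field of `a`. -/
theorem poisson_eq_diffAt [FiniteDimensional ℝ E] (a b : Cotangent E G → ℝ) (l : Cotangent E G) :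
    poisson a b l = diffAt (cotangentModel E) b l (hamiltonianField a l) :=
  isHamiltonianVector_hamiltonianField b l _

theorem poisson_swap (a b : Cotangent E G → ℝ) (l : Cotangent E G) :
    poisson a b l = -poisson b a l := by
  have h1 := symplecticForm_apply l (hamiltonianField a l) (hamiltonianField b l)
  have h2 := symplecticForm_apply l (hamiltonianField b l) (hamiltonianField a l)
  unfold poisson
  rw [h1, h2]; ring

theorem poisson_self (a : Cotangent E G → ℝ) (l : Cotangent E G) : poisson a a l = 0 := by
  have := poisson_swap a a l
  linarith

/-- The function on `T*G` given by pairing with a vector field. -/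
noncomputable def fieldHam (X : (q : G) → TangentSpace 𝓘(ℝ, E) q) (l : Cotangent E G) : ℝ :=
  pairing l (X l.proj)

theorem contMDiff_fieldHam {X : (q : G) → TangentSpace 𝓘(ℝ, E) q}
    (hX : ContMDiff 𝓘(ℝ, E) 𝓘(ℝ, E).tangent ∞ (fun q => (X q : TangentBundle 𝓘(ℝ, E) G))) :
    ContMDiff (cotangentModel E) 𝓘(ℝ, ℝ) ∞ (fieldHam X) := by
  have h1 : ContMDiff (cotangentModel E) (𝓘(ℝ, E).prod 𝓘(ℝ, ℝ)) ∞
      (fun m : Cotangent E G => TotalSpace.mk' ℝ (E := Trivial G ℝ) m.proj (m.snd (X m.proj))) :=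
    ContMDiff.clm_bundle_apply (F₁ := E) (F₂ := ℝ) (b := fun m : Cotangent E G => m.proj)
      (ϕ := fun m => m.snd) (v := fun m => X m.proj) contMDiff_id
      (hX.comp contMDiff_cotangent_proj)
  intro l
  exact (contMDiffAt_totalSpace.1 (h1 l)).2

/-- The expression of a vector field in the preferred chart at `q`. -/
noncomputable def fieldInChart (X : (q : G) → TangentSpace 𝓘(ℝ, E) q) (q : G) : E → E :=
  mpullbackWithin 𝓘(ℝ, E) 𝓘(ℝ, E) (extChartAt 𝓘(ℝ, E) q).symm X (range 𝓘(ℝ, E))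

theorem fieldInChart_apply (X : (q : G) → TangentSpace 𝓘(ℝ, E) q) (q : G) {x : E}
    (hx : x ∈ (extChartAt 𝓘(ℝ, E) q).target) :
    fieldInChart X q x = mfderiv 𝓘(ℝ, E) 𝓘(ℝ, E) (extChartAt 𝓘(ℝ, E) q)
      ((extChartAt 𝓘(ℝ, E) q).symm x) (X ((extChartAt 𝓘(ℝ, E) q).symm x)) := by
  unfold fieldInChart
  have h := ContinuousLinearMap.inverse_eq
    (mfderivWithin_extChartAt_symm_comp_mfderiv_extChartAt hx)
    (mfderiv_extChartAt_comp_mfderivWithin_extChartAt_symm hx)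
  exact congrArg (fun L : E →L[ℝ] E => L (X ((extChartAt 𝓘(ℝ, E) q).symm x))) h

/-- At the base point of the preferred chart, whose derivative there is the identity, a field equals
its expression in the chart. -/
theorem fieldInChart_self (X : (q : G) → TangentSpace 𝓘(ℝ, E) q) (q : G) :
    fieldInChart X q (extChartAt 𝓘(ℝ, E) q q) = X q := by
  rw [fieldInChart_apply X q (mem_extChartAt_target q)]
  have h : (extChartAt 𝓘(ℝ, E) q).symm (extChartAt 𝓘(ℝ, E) q q) = q := extChartAt_to_inv q
  rw [h, mfderiv_extChartAt_self]
  rfl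

theorem differentiableAt_fieldInChart [FiniteDimensional ℝ E]
    {X : (q : G) → TangentSpace 𝓘(ℝ, E) q} {q : G}
    (hX : MDifferentiableAt 𝓘(ℝ, E) 𝓘(ℝ, E).tangent
      (fun q => (X q : TangentBundle 𝓘(ℝ, E) G)) q) :
    DifferentiableAt ℝ (fieldInChart X q) (extChartAt 𝓘(ℝ, E) q q) := by
  have := FiniteDimensional.complete ℝ E
  rw [← mdifferentiableWithinAt_univ] at hX
  have h : DifferentiableWithinAt ℝ (fieldInChart X q)
      ((extChartAt 𝓘(ℝ, E) q).symm ⁻¹' univ ∩ range 𝓘(ℝ, E)) (extChartAt 𝓘(ℝ, E) q q) :=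
    hX.differentiableWithinAt_mpullbackWithin_vectorField
  rwa [preimage_univ, univ_inter, ModelWithCorners.range_eq_univ, differentiableWithinAt_univ] at h

theorem mlieBracket_eq_fieldInChart (X Y : (q : G) → TangentSpace 𝓘(ℝ, E) q) (q : G) :
    mlieBracket 𝓘(ℝ, E) X Y q =
      fderiv ℝ (fieldInChart Y q) (extChartAt 𝓘(ℝ, E) q q) (X q) -
      fderiv ℝ (fieldInChart X q) (extChartAt 𝓘(ℝ, E) q q) (Y q) := by
  have h : mlieBracket 𝓘(ℝ, E) X Y q = (ContinuousLinearMap.id ℝ E).inverse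
      (lieBracketWithin ℝ (fieldInChart X q) (fieldInChart Y q)
        ((extChartAt 𝓘(ℝ, E) q).symm ⁻¹' univ ∩ range 𝓘(ℝ, E)) (extChartAt 𝓘(ℝ, E) q q)) := by
    rw [← mlieBracketWithin_univ, mlieBracketWithin_apply, mfderiv_extChartAt_self]
    rfl
  rw [h, preimage_univ, univ_inter, ModelWithCorners.range_eq_univ, lieBracketWithin_univ,
    ContinuousLinearMap.inverse_id, ← fieldInChart_self X q, ← fieldInChart_self Y q]
  rfl

/-- The differential of the momentum function `⟨l, X⟩`: in the chart it is `(x, p) ↦ p (X x)`, so a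
vertical vector is paired with `X`, and a horizontal one meets the derivative of `X`. -/
theorem diffAt_fieldHam [FiniteDimensional ℝ E] {X : (q : G) → TangentSpace 𝓘(ℝ, E) q}
    (hX : ContMDiff 𝓘(ℝ, E) 𝓘(ℝ, E).tangent ∞ (fun q => (X q : TangentBundle 𝓘(ℝ, E) G)))
    (l : Cotangent E G) (w : E × (E →L[ℝ] ℝ)) :
    diffAt (cotangentModel E) (fieldHam X) l w =
      w.2 (X l.proj) + (l.snd : E →L[ℝ] ℝ)
        (fderiv ℝ (fieldInChart X l.proj) (extChartAt 𝓘(ℝ, E) l.proj l.proj) w.1) := by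
  set x₀ := extChartAt 𝓘(ℝ, E) l.proj l.proj
  set z₀ := extChartAt (cotangentModel E) l l
  have hz₁ : z₀.1 = x₀ := by
    simp only [z₀, extChartAt_cotangent_apply]; rfl
  have hz₂ : z₀.2 = l.snd := by
    have h := extChartAt_cotangent_symm_snd l (mem_extChartAt_target l)
    rw [extChartAt_to_inv, mfderiv_extChartAt_self] at h
    exact h.symm
  have hd := (contMDiff_fieldHam hX).mdifferentiableAt (x := l) (by simp)
  have hDX := differentiableAt_fieldInChart (hX.mdifferentiableAt (x := l.proj) (by simp))
  have hev : writtenInExtChartAt (cotangentModel E) 𝓘(ℝ, ℝ) l (fieldHam X) =ᶠ[𝓝 z₀]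
      fun z : E × (E →L[ℝ] ℝ) => z.2 (fieldInChart X l.proj z.1) := by
    filter_upwards [extChartAt_target_mem_nhds (I := cotangentModel E) l] with z hz
    rw [fieldInChart_apply X l.proj (mem_extChartAt_cotangent_target.1 hz),
      ← extChartAt_cotangent_symm_proj l hz]
    exact congrArg (fun L : E →L[ℝ] ℝ => L (X _)) (extChartAt_cotangent_symm_snd l hz)
  unfold diffAt
  rw [hd.mfderiv, ModelWithCorners.range_eq_univ, fderivWithin_univ, hev.fderiv_eq]
  have h1 : HasFDerivAt (fun z : E × (E →L[ℝ] ℝ) => fieldInChart X l.proj z.1) _ z₀ :=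
    HasFDerivAt.comp z₀ (f := Prod.fst) (by rw [hz₁]; exact hDX.hasFDerivAt) hasFDerivAt_fst
  have h2 : HasFDerivAt (fun z : E × (E →L[ℝ] ℝ) => z.2 (fieldInChart X l.proj z.1)) _ z₀ :=
    hasFDerivAt_snd.clm_apply h1
  rw [h2.fderiv, hz₁, hz₂, fieldInChart_self]
  exact add_comm _ _

/-- The linear algebra behind the Poisson bracket of two momentum functions: `(v, η)` is the
Hamiltonian vector of the function with differential `(y, q) ↦ q x + p (A y)`, and it is evaluated
on the differential `(y', q) ↦ q y + p (B y')`. -/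
theorem apply_add_apply_eq_of_forall_sub_eq {x v : E} {p η : E →L[ℝ] ℝ} {A : E →L[ℝ] E}
    (h : ∀ w : E × (E →L[ℝ] ℝ), w.2 v - η w.1 = w.2 x + p (A w.1)) (y : E) (B : E →L[ℝ] E) :
    η y + p (B v) = p (B x - A y) := by
  have hv : v = x := by
    refine (SeparatingDual.eq_iff_forall_dual_eq (R := ℝ)).2 fun g => ?_
    simpa using h (0, g)
  have hy := h (y, 0)
  simp only [_root_.zero_apply] at hy
  rw [hv, map_sub]
  linarith

/-- The Poisson bracket of the momentum functions of two vector fields is the momentum function of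
their Lie bracket. -/
theorem poisson_fieldHam [FiniteDimensional ℝ E] {X Y : (q : G) → TangentSpace 𝓘(ℝ, E) q}
    (hX : ContMDiff 𝓘(ℝ, E) 𝓘(ℝ, E).tangent ∞ (fun q => (X q : TangentBundle 𝓘(ℝ, E) G)))
    (hY : ContMDiff 𝓘(ℝ, E) 𝓘(ℝ, E).tangent ∞ (fun q => (Y q : TangentBundle 𝓘(ℝ, E) G)))
    (l : Cotangent E G) :
    poisson (fieldHam X) (fieldHam Y) l = fieldHam (mlieBracket 𝓘(ℝ, E) X Y) l := by
  obtain ⟨v₁, v₂, hv⟩ : ∃ (v₁ : E) (v₂ : E →L[ℝ] ℝ), hamiltonianField (fieldHam X) l = (v₁, v₂) :=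
    ⟨_, _, rfl⟩
  have key : ∀ w : E × (E →L[ℝ] ℝ), w.2 v₁ - v₂ w.1 =
      w.2 (X l.proj) + (l.snd : E →L[ℝ] ℝ)
        (fderiv ℝ (fieldInChart X l.proj) (extChartAt 𝓘(ℝ, E) l.proj l.proj) w.1) := by
    intro w
    have h := isHamiltonianVector_hamiltonianField (fieldHam X) l w
    rw [hv] at h
    exact (symplecticForm_apply l w (v₁, v₂)).symm.trans (h.trans (diffAt_fieldHam hX l w))
  rw [poisson_eq_diffAt, hv]
  refine (diffAt_fieldHam hY l (v₁, v₂)).trans ?_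
  unfold fieldHam pairing
  rw [mlieBracket_eq_fieldInChart]
  exact apply_add_apply_eq_of_forall_sub_eq key _ _

end

/-! ### Commuting vector fields from mixed partial derivatives -/

section

variable {E : Type*} [NormedAddCommGroup E] [NormedSpace ℝ E]
  {G : Type*} [TopologicalSpace G] [ChartedSpace E G] [IsManifold 𝓘(ℝ, E) ∞ G]

/-- The field `q ↦ ∂₂F(q, b q) V(q)` along a map of two variables is smooth: it is the tangent map
of `F` applied to `(0, V)`. -/
theorem contMDiff_mfderiv_snd {F : G × G → G}
    (hF : ContMDiff (𝓘(ℝ, E).prod 𝓘(ℝ, E)) 𝓘(ℝ, E) ∞ F) {b : G → G}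
    {V : (q : G) → TangentSpace 𝓘(ℝ, E) (b q)}
    (hV : ContMDiff 𝓘(ℝ, E) 𝓘(ℝ, E).tangent ∞ (fun q => (⟨b q, V q⟩ : TangentBundle 𝓘(ℝ, E) G))) :
    ContMDiff 𝓘(ℝ, E) 𝓘(ℝ, E).tangent ∞ (fun q => (⟨F (q, b q),
      mfderiv 𝓘(ℝ, E) 𝓘(ℝ, E) (fun x => F (q, x)) (b q) (V q)⟩ : TangentBundle 𝓘(ℝ, E) G)) := by
  have h0 : ContMDiff 𝓘(ℝ, E) 𝓘(ℝ, E).tangent ∞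
      (fun q => (⟨q, 0⟩ : TangentBundle 𝓘(ℝ, E) G)) := contMDiff_zeroSection _ _
  have h1 := (contMDiff_equivTangentBundleProd_symm (I := 𝓘(ℝ, E)) (M := G) (I' := 𝓘(ℝ, E))
    (M' := G) (n := ∞)).comp (h0.prodMk hV)
  have h2 := (ContMDiff.contMDiff_tangentMap hF (m := ∞) le_rfl).comp h1
  convert! h2 using 2 with q
  refine congrArg (TotalSpace.mk' E (F (q, b q))) ?_
  let v : E := V q
  have h3 := mfderiv_prod_eq_add_apply (hF.mdifferentiableAt (x := (q, b q)) (by simp))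
    (v := ((0 : E), v))
  have h4 : (mfderiv 𝓘(ℝ, E) 𝓘(ℝ, E) (fun z => F (z, b q)) q : E →L[ℝ] E) 0 +
      (mfderiv 𝓘(ℝ, E) 𝓘(ℝ, E) (fun x => F (q, x)) (b q) : E →L[ℝ] E) (V q) =
      (mfderiv 𝓘(ℝ, E) 𝓘(ℝ, E) (fun x => F (q, x)) (b q) : E →L[ℝ] E) (V q) := by
    rw [map_zero, zero_add]
  exact (h3.trans h4).symm

/-- In the chart at `q`, a field of the form `Y(g) = ∂₂F(g, q) Y(q)` is a partial derivative of `F`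
read in the chart. -/
theorem fieldInChart_eq_fderiv {F : G × G → G}
    (hF : ContMDiff (𝓘(ℝ, E).prod 𝓘(ℝ, E)) 𝓘(ℝ, E) ∞ F) {q : G} (hq : ∀ g, F (g, q) = g)
    {Y : (q : G) → TangentSpace 𝓘(ℝ, E) q}
    (hY : ∀ g, (Y g : E) = (mfderiv 𝓘(ℝ, E) 𝓘(ℝ, E) (fun x => F (g, x)) q : E →L[ℝ] E) (Y q))
    {x : E} (hx : x ∈ (extChartAt 𝓘(ℝ, E) q).target) :
    fieldInChart Y q x = fderiv ℝ (fun y => extChartAt 𝓘(ℝ, E) q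
        (F ((extChartAt 𝓘(ℝ, E) q).symm x, (extChartAt 𝓘(ℝ, E) q).symm y)))
      (extChartAt 𝓘(ℝ, E) q q) (Y q) := by
  rw [fieldInChart_apply Y q hx]
  set φ := extChartAt 𝓘(ℝ, E) q
  set g := φ.symm x
  have hg : g ∈ (chartAt E q).source := by
    rw [← extChartAt_source (I := 𝓘(ℝ, E))]; exact φ.map_target hx
  have hq0 : φ.symm (φ q) = q := extChartAt_to_inv q
  have h1 : HasMFDerivAt 𝓘(ℝ, E) 𝓘(ℝ, E) φ (F (g, φ.symm (φ q)))
      (mfderiv 𝓘(ℝ, E) 𝓘(ℝ, E) φ g : E →L[ℝ] E) := by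
    rw [hq0, hq g]; exact (mdifferentiableAt_extChartAt hg).hasMFDerivAt
  have h2 : HasMFDerivAt 𝓘(ℝ, E) 𝓘(ℝ, E) (fun y => F (g, y)) (φ.symm (φ q))
      (mfderiv 𝓘(ℝ, E) 𝓘(ℝ, E) (fun x => F (g, x)) q : E →L[ℝ] E) := by
    rw [hq0]
    exact ((hF.comp (contMDiff_const.prodMk contMDiff_id)).mdifferentiableAt (by simp)).hasMFDerivAt
  have h3 : HasMFDerivAt 𝓘(ℝ, E) 𝓘(ℝ, E) φ.symm (φ q) (ContinuousLinearMap.id ℝ E) := by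
    have h := (mdifferentiableWithinAt_extChartAt_symm (I := 𝓘(ℝ, E))
      (mem_extChartAt_target q)).hasMFDerivWithinAt
    rw [mfderivWithin_range_extChartAt_symm, ModelWithCorners.range_eq_univ] at h
    exact hasMFDerivWithinAt_univ.1 h
  obtain ⟨L, hL⟩ : ∃ L : E →L[ℝ] E, L = (mfderiv 𝓘(ℝ, E) 𝓘(ℝ, E) φ g : E →L[ℝ] E) ∘L
        (mfderiv 𝓘(ℝ, E) 𝓘(ℝ, E) (fun x => F (g, x)) q : E →L[ℝ] E) := ⟨_, rfl⟩
  have h4 : HasFDerivAt (fun y => φ (F (g, φ.symm y))) L (φ q) := by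
    have h := HasMFDerivAt.comp (φ q) h1 (HasMFDerivAt.comp (φ q) h2 h3)
    rw [hL]
    exact hasMFDerivAt_iff_hasFDerivAt.1 h
  rw [h4.fderiv, hL]
  exact congrArg (mfderiv 𝓘(ℝ, E) 𝓘(ℝ, E) φ g : E →L[ℝ] E) (hY g)

/-- Symmetry of second derivatives: `∂_X ∂_Y m = ∂_Y ∂_X m` for the two mixed partial derivatives.
-/
theorem fderiv_eq_fderiv_of_partial {m : E × E → E} {x₀ : E}
    (hm : ContDiffAt ℝ 2 m (x₀, x₀)) (X Y : E)
    {f e : E → E} (hf : ∀ᶠ x in 𝓝 x₀, f x = fderiv ℝ (fun y => m (x, y)) x₀ Y)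
    (he : ∀ᶠ y in 𝓝 x₀, e y = fderiv ℝ (fun x => m (x, y)) x₀ X) :
    fderiv ℝ f x₀ X = fderiv ℝ e x₀ Y := by
  have hev : ∀ᶠ z in 𝓝 (x₀, x₀), DifferentiableAt ℝ m z := by
    filter_upwards [hm.eventually (by simp)] with z hz using hz.differentiableAt (by simp)
  have hD : DifferentiableAt ℝ (fderiv ℝ m) (x₀, x₀) :=
    (hm.fderiv_right (m := 1) (by norm_num)).differentiableAt (by simp)
  have hf' : f =ᶠ[𝓝 x₀] fun x => fderiv ℝ m (x, x₀) (0, Y) := by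
    have hc : Filter.Tendsto (fun x : E => (x, x₀)) (𝓝 x₀) (𝓝 (x₀, x₀)) :=
      (by fun_prop : Continuous fun x : E => (x, x₀)).tendsto x₀
    filter_upwards [hf, hc.eventually hev] with x hx hd
    rw [hx]
    have := hd.hasFDerivAt.comp x₀ (hasFDerivAt_prodMk_right x x₀)
    rw [show (fun y => m (x, y)) = m ∘ fun y => (x, y) from rfl, this.fderiv]
    simp
  have he' : e =ᶠ[𝓝 x₀] fun y => fderiv ℝ m (x₀, y) (X, 0) := by
    have hc : Filter.Tendsto (fun y : E => (x₀, y)) (𝓝 x₀) (𝓝 (x₀, x₀)) :=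
      (by fun_prop : Continuous fun y : E => (x₀, y)).tendsto x₀
    filter_upwards [he, hc.eventually hev] with y hy hd
    rw [hy]
    have := HasFDerivAt.comp x₀ (f := fun x => (x, y)) hd.hasFDerivAt (hasFDerivAt_prodMk_left x₀ y)
    rw [show (fun x => m (x, y)) = m ∘ fun x => (x, y) from rfl, this.fderiv]
    simp
  have h1 : HasFDerivAt (fun x : E => fderiv ℝ m (x, x₀) (0, Y)) _ x₀ :=
    (HasFDerivAt.comp x₀ (f := fun x => (x, x₀)) hD.hasFDerivAt
      (hasFDerivAt_prodMk_left x₀ x₀)).clm_apply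
      (hasFDerivAt_const ((0 : E), Y) x₀)
  have h2 : HasFDerivAt (fun y : E => fderiv ℝ m (x₀, y) (X, 0)) _ x₀ :=
    (hD.hasFDerivAt.comp x₀ (hasFDerivAt_prodMk_right x₀ x₀)).clm_apply
      (hasFDerivAt_const (X, (0 : E)) x₀)
  rw [hf'.fderiv_eq, he'.fderiv_eq, h1.fderiv, h2.fderiv]
  have hs := hm.isSymmSndFDerivAt (by simp) (X, 0) (0, Y)
  simpa using hs

/-- Let `F` be a local product with unit `q`. A field extended by differentiating `F` in the first
variable commutes at `q` with a field extended by differentiating in the second one: the two terms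
of the bracket are the two mixed second derivatives of `F`. -/
theorem mlieBracket_eq_zero_of_partial {F : G × G → G}
    (hF : ContMDiff (𝓘(ℝ, E).prod 𝓘(ℝ, E)) 𝓘(ℝ, E) ∞ F) {q : G} (hq : ∀ g, F (g, q) = g)
    (hq' : ∀ g, F (q, g) = g) {X Y : (q : G) → TangentSpace 𝓘(ℝ, E) q}
    (hX : ∀ g, (X g : E) = (mfderiv 𝓘(ℝ, E) 𝓘(ℝ, E) (fun x => F (x, g)) q : E →L[ℝ] E) (X q))
    (hY : ∀ g, (Y g : E) = (mfderiv 𝓘(ℝ, E) 𝓘(ℝ, E) (fun x => F (g, x)) q : E →L[ℝ] E) (Y q)) :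
    mlieBracket 𝓘(ℝ, E) X Y q = 0 := by
  rw [mlieBracket_eq_fieldInChart]
  refine sub_eq_zero.2 ?_
  set φ := extChartAt 𝓘(ℝ, E) q
  have hφ : ContMDiffAt 𝓘(ℝ, E) 𝓘(ℝ, E) ∞ φ.symm (φ q) := by
    have := contMDiffWithinAt_extChartAt_symm_range (I := 𝓘(ℝ, E)) (n := ∞) q
      (mem_extChartAt_target q)
    rwa [ModelWithCorners.range_eq_univ, contMDiffWithinAt_univ] at this
  have hq0 : φ.symm (φ q) = q := extChartAt_to_inv q
  have hm : ContDiffAt ℝ ∞ (fun z : E × E => φ (F (φ.symm z.1, φ.symm z.2))) (φ q, φ q) := by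
    rw [← contMDiffAt_iff_contDiffAt]
    have h1 : ContMDiffAt 𝓘(ℝ, E × E) 𝓘(ℝ, E) ∞ (fun z : E × E => φ.symm z.1) (φ q, φ q) :=
      ContMDiffAt.comp (φ q, φ q) (f := Prod.fst) hφ contDiffAt_fst.contMDiffAt
    have h2 : ContMDiffAt 𝓘(ℝ, E × E) 𝓘(ℝ, E) ∞ (fun z : E × E => φ.symm z.2) (φ q, φ q) :=
      ContMDiffAt.comp (φ q, φ q) (f := Prod.snd) hφ contDiffAt_snd.contMDiffAt
    refine ContMDiffAt.comp (φ q, φ q) (g := φ) ?_ ((hF _).comp _ (h1.prodMk h2))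
    simp only [hq0, hq]
    exact contMDiffAt_extChartAt
  have ht := extChartAt_target_mem_nhds (I := 𝓘(ℝ, E)) q
  refine fderiv_eq_fderiv_of_partial (hm.of_le (WithTop.coe_le_coe.2 (le_top : (2 : ℕ∞) ≤ ⊤)))
    (X q) (Y q) ?_ ?_
  · filter_upwards [ht] with x hx
    exact fieldInChart_eq_fderiv hF hq hY hx
  · filter_upwards [ht] with x hx
    exact fieldInChart_eq_fderiv (F := fun z => F (z.2, z.1))
      (hF.comp (contMDiff_snd.prodMk contMDiff_fst)) hq' hX hx

end

/-! ### Left- and right-invariant vector fields -/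

section

variable {E : Type*} [NormedAddCommGroup E] [NormedSpace ℝ E]
  {G : Type*} [TopologicalSpace G] [ChartedSpace E G]

variable (E) in
/-- The derivative at `x` of a self-map of `G`, as an endomorphism of the model space `E`, the
underlying space of every tangent space of `G`. -/
noncomputable def tderiv (f : G → G) (x : G) : E →L[ℝ] E := mfderiv 𝓘(ℝ, E) 𝓘(ℝ, E) f x

variable (E) in
/-- The chain rule, with the composite and the intermediate point given up to propositional
equality. -/
theorem tderiv_tderiv {f g k : G → G} (hg : ContMDiff 𝓘(ℝ, E) 𝓘(ℝ, E) ∞ g)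
    (hf : ContMDiff 𝓘(ℝ, E) 𝓘(ℝ, E) ∞ f) {x y : G} (h : f x = y) (hk : ∀ z, g (f z) = k z)
    (v : E) : tderiv E g y (tderiv E f x v) = tderiv E k x v := by
  subst h
  obtain rfl : (fun z => g (f z)) = k := funext hk
  have h := mfderiv_comp x (hg.mdifferentiableAt (x := f x) (by simp))
    (hf.mdifferentiableAt (x := x) (by simp))
  exact congrArg (fun L : E →L[ℝ] E => L v) h.symm

variable (E) in
theorem tderiv_id (x : G) (v : E) : tderiv E (fun z : G => z) x v = v :=
  congrArg (fun L : E →L[ℝ] E => L v) (mfderiv_id (I := 𝓘(ℝ, E)) (x := x))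

variable (E) in
theorem tangentBundle_mk_eq {x y : G} (h : x = y) (w : E) :
    (⟨x, w⟩ : TangentBundle 𝓘(ℝ, E) G) = ⟨y, w⟩ := by
  subst h; rfl

variable [Group G]

theorem leftField_eq (v : GroupLieAlgebra 𝓘(ℝ, E) G) (q : G) :
    (mulInvariantVectorField v q : E) = tderiv E (fun x : G => q * x) 1 v := rfl

variable [LieGroup 𝓘(ℝ, E) ∞ G]

/-- The right-invariant field of `v` is the derivative of `x ↦ x⁻¹ q` at the identity. -/
theorem rightField_eq (v : GroupLieAlgebra 𝓘(ℝ, E) G) (q : G) :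
    (rightField v q : E) = tderiv E (fun x : G => x⁻¹ * q) 1 v := by
  have hi : ContMDiff 𝓘(ℝ, E) 𝓘(ℝ, E) ∞ (fun x : G => x⁻¹) := contMDiff_inv _ _
  have hinv : (tderiv E (fun x : G => x⁻¹) q : E →L[ℝ] E).inverse =
      tderiv E (fun x : G => x⁻¹) q⁻¹ :=
    ContinuousLinearMap.inverse_eq
      (ContinuousLinearMap.ext fun w =>
        (tderiv_tderiv E hi hi (inv_inv q) inv_inv w).trans (tderiv_id E _ w))
      (ContinuousLinearMap.ext fun w =>
        (tderiv_tderiv E hi hi rfl inv_inv w).trans (tderiv_id E _ w))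
  have h := tderiv_tderiv E (x := (1 : G)) (k := fun x : G => x⁻¹ * q) hi
    (contMDiff_mul_left (I := 𝓘(ℝ, E)) (n := ∞) (a := q⁻¹)) (mul_one q⁻¹) (by simp) v
  exact (congrArg (fun L : E →L[ℝ] E => L (mulInvariantVectorField v q⁻¹)) hinv).trans h

theorem contMDiff_leftField (v : GroupLieAlgebra 𝓘(ℝ, E) G) :
    ContMDiff 𝓘(ℝ, E) 𝓘(ℝ, E).tangent ∞
      (fun q : G => (mulInvariantVectorField v q : TangentBundle 𝓘(ℝ, E) G)) := by
  have h := contMDiff_mfderiv_snd (F := fun z : G × G => z.1 * z.2) (b := fun _ => 1)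
    (V := fun _ => v) (contMDiff_mul 𝓘(ℝ, E) ∞) contMDiff_const
  convert! h using 2 with q
  exact tangentBundle_mk_eq E (mul_one q).symm _

theorem contMDiff_rightField (v : GroupLieAlgebra 𝓘(ℝ, E) G) :
    ContMDiff 𝓘(ℝ, E) 𝓘(ℝ, E).tangent ∞
      (fun q : G => (rightField v q : TangentBundle 𝓘(ℝ, E) G)) := by
  have h := contMDiff_mfderiv_snd (F := fun z : G × G => z.2⁻¹ * z.1) (b := fun _ => 1)
    (V := fun _ => v) (contMDiff_snd.inv.mul contMDiff_fst) contMDiff_const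
  convert! h using 2 with q
  refine (tangentBundle_mk_eq E (by simp : q = 1⁻¹ * q) _).trans ?_
  exact congrArg (TotalSpace.mk' E (E := TangentSpace 𝓘(ℝ, E)) (1⁻¹ * q)) (rightField_eq v q)

/-- Left- and right-invariant fields commute, being the two partial derivatives of the product
`(x, y) ↦ x q⁻¹ y`, which has `q` as unit. -/
theorem mlieBracket_rightField_leftField
    (u v : GroupLieAlgebra 𝓘(ℝ, E) G) :
    mlieBracket 𝓘(ℝ, E) (rightField u) (mulInvariantVectorField v) =
      (0 : (q : G) → TangentSpace 𝓘(ℝ, E) q) := by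
  funext q
  refine mlieBracket_eq_zero_of_partial (F := fun z : G × G => z.1 * q⁻¹ * z.2)
    ((contMDiff_fst.mul contMDiff_const).mul contMDiff_snd) (by simp) (by simp) (fun g => ?_)
    fun g => ?_
  · rw [rightField_eq, rightField_eq]
    exact (tderiv_tderiv E (f := fun x => x⁻¹ * q) (g := fun x => x * q⁻¹ * g)
      (k := fun x => x⁻¹ * g) ((contMDiff_id.mul contMDiff_const).mul contMDiff_const)
      ((contMDiff_inv 𝓘(ℝ, E) ∞).mul contMDiff_const) (by simp) (by simp) u).symm
  · rw [leftField_eq, leftField_eq]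
    exact (tderiv_tderiv E (g := fun x => g * q⁻¹ * x) (k := fun x => g * x) contMDiff_mul_left
      contMDiff_mul_left (mul_one q) (by simp [mul_assoc]) v).symm

theorem lieGroup_minSmoothness : LieGroup 𝓘(ℝ, E) (minSmoothness ℝ 3) G :=
  LieGroup.of_le (n := ∞) (by simpa using WithTop.coe_le_coe.2 (le_top : (3 : ℕ∞) ≤ ⊤))

theorem mlieBracket_leftField [FiniteDimensional ℝ E] (u v : GroupLieAlgebra 𝓘(ℝ, E) G) :
    mlieBracket 𝓘(ℝ, E) (mulInvariantVectorField u) (mulInvariantVectorField v) =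
      (mulInvariantVectorField ⁅u, v⁆ : (q : G) → TangentSpace 𝓘(ℝ, E) q) := by
  have := FiniteDimensional.complete ℝ E
  have := lieGroup_minSmoothness (E := E) (G := G)
  rw [GroupLieAlgebra.bracket_def, mulInvariantVector_mlieBracket]

/-- Pulling back along the inversion preserves brackets, so the right-invariant fields obtained in
this way form a copy of the Lie algebra with the same structure constants. -/
theorem mlieBracket_rightField [FiniteDimensional ℝ E] (u v : GroupLieAlgebra 𝓘(ℝ, E) G) :
    mlieBracket 𝓘(ℝ, E) (rightField u) (rightField v) =
      (rightField ⁅u, v⁆ : (q : G) → TangentSpace 𝓘(ℝ, E) q) := by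
  have := FiniteDimensional.complete ℝ E
  have h2 : minSmoothness ℝ 2 ≤ ∞ := by
    simpa using WithTop.coe_le_coe.2 (le_top : (2 : ℕ∞) ≤ ⊤)
  have : IsManifold 𝓘(ℝ, E) (minSmoothness ℝ 2) G := IsManifold.of_le (n := ∞) h2
  funext q
  unfold rightField
  rw [← mlieBracket_leftField]
  refine (mpullback_mlieBracket (n := ∞) ?_ ?_ ?_ h2).symm
  · exact (contMDiff_leftField u).mdifferentiableAt (by simp)
  · exact (contMDiff_leftField v).mdifferentiableAt (by simp)
  · exact (contMDiff_inv _ _).contMDiffAt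

/-- Left translation of tangent vectors to the identity: the inverse of `v ↦ f_v(q)`, with `f_v`
the left-invariant field with value `v` at the identity. -/
noncomputable def leftTrans (q : G) (v : TangentSpace 𝓘(ℝ, E) q) : GroupLieAlgebra 𝓘(ℝ, E) G :=
  tderiv E (fun x : G => q⁻¹ * x) q v

theorem leftField_leftTrans (q : G) (v : TangentSpace 𝓘(ℝ, E) q) :
    mulInvariantVectorField (leftTrans q v) q = v :=
  (tderiv_tderiv E contMDiff_mul_left contMDiff_mul_left (inv_mul_cancel q)
    (mul_inv_cancel_left q) (v : E)).trans (tderiv_id E q v)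

theorem leftTrans_leftField (q : G) (v : GroupLieAlgebra 𝓘(ℝ, E) G) :
    leftTrans q (mulInvariantVectorField v q) = v :=
  (tderiv_tderiv E contMDiff_mul_left contMDiff_mul_left (mul_one q)
    (inv_mul_cancel_left q) (v : E)).trans (tderiv_id E 1 v)

theorem contMDiff_leftTrans {X : (q : G) → TangentSpace 𝓘(ℝ, E) q}
    (hX : ContMDiff 𝓘(ℝ, E) 𝓘(ℝ, E).tangent ∞ (fun q => (X q : TangentBundle 𝓘(ℝ, E) G))) :
    ContMDiff 𝓘(ℝ, E) 𝓘(ℝ, E) ∞ (fun q : G => (show E from leftTrans q (X q))) := by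
  have h := contMDiff_mfderiv_snd (F := fun z : G × G => z.1⁻¹ * z.2) (b := fun q => q)
    (V := X) (contMDiff_fst.inv.mul contMDiff_snd) hX
  have h' : ContMDiff 𝓘(ℝ, E) 𝓘(ℝ, E).tangent ∞
      (fun q => (⟨1, leftTrans q (X q)⟩ : TangentBundle 𝓘(ℝ, E) G)) := by
    convert! h using 2 with q
    exact tangentBundle_mk_eq E (inv_mul_cancel q).symm _
  intro q
  have h2 := (contMDiffAt_totalSpace.1 (h' q)).2
  refine h2.congr_of_eventuallyEq (Filter.Eventually.of_forall fun p => ?_)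
  exact ((tangentBundleCore 𝓘(ℝ, E) G).coordChange_self (achart E (1 : G)) 1
    (mem_chart_source E (1 : G)) (leftTrans p (X p))).symm

end

/-! ### Differentials of functions of functions, and first integrals -/

section

variable {F : Type*} [NormedAddCommGroup F] [NormedSpace ℝ F]
  {K : Type*} [TopologicalSpace K] {J : ModelWithCorners ℝ F K}
  {M : Type*} [TopologicalSpace M] [ChartedSpace K M]

/-- The chain rule for a function `Φ` of finitely many functions `a i`. -/
theorem diffAt_comp [J.Boundaryless] {ι : Type*} [Fintype ι] {a : ι → M → ℝ} {x : M}
    (ha : ∀ i, MDifferentiableAt J 𝓘(ℝ, ℝ) (a i) x) {Φ : (ι → ℝ) → ℝ} {Φ' : (ι → ℝ) →L[ℝ] ℝ}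
    (hΦ : HasFDerivAt Φ Φ' (fun i => a i x)) (w : TangentSpace J x) :
    diffAt J (fun y => Φ fun i => a i y) x w = Φ' fun i => diffAt J (a i) x w := by
  have h1 : ∀ i, HasFDerivAt (fun z => a i ((extChartAt J x).symm z))
      (mfderiv J 𝓘(ℝ, ℝ) (a i) x : F →L[ℝ] ℝ) (extChartAt J x x) := by
    intro i
    have h := (ha i).hasMFDerivAt.2
    rw [ModelWithCorners.range_eq_univ] at h
    exact hasFDerivWithinAt_univ.1 h
  have h2 : HasFDerivAt (fun z i => a i ((extChartAt J x).symm z))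
      (ContinuousLinearMap.pi fun i => (mfderiv J 𝓘(ℝ, ℝ) (a i) x : F →L[ℝ] ℝ))
      (extChartAt J x x) := hasFDerivAt_pi.2 h1
  obtain ⟨L, hL⟩ : ∃ L : F →L[ℝ] ℝ, L = Φ'.comp
      (ContinuousLinearMap.pi fun i => (mfderiv J 𝓘(ℝ, ℝ) (a i) x : F →L[ℝ] ℝ)) := ⟨_, rfl⟩
  have h3 : HasFDerivWithinAt (fun z => Φ fun i => a i ((extChartAt J x).symm z)) L (range J)
      (extChartAt J x x) := by
    rw [hL]
    refine (HasFDerivAt.comp (extChartAt J x x) ?_ h2).hasFDerivWithinAt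
    simpa only [extChartAt_to_inv] using hΦ
  have h4 : HasMFDerivAt J 𝓘(ℝ, ℝ) (fun y => Φ fun i => a i y) x L :=
    ⟨hΦ.continuousAt.comp (f := fun y i => a i y)
      (continuousAt_pi.2 fun i => (ha i).continuousAt), h3⟩
  refine (congrArg (fun L : F →L[ℝ] ℝ => L w) h4.mfderiv).trans ?_
  rw [hL]
  rfl

theorem diffAt_sum_sq [J.Boundaryless] {ι : Type*} [Fintype ι] (c : ι → ℝ) {a : ι → M → ℝ} {x : M}
    (ha : ∀ i, MDifferentiableAt J 𝓘(ℝ, ℝ) (a i) x) (w : TangentSpace J x) :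
    diffAt J (fun y => ∑ i, c i * a i y ^ 2) x w = ∑ i, 2 * c i * a i x * diffAt J (a i) x w := by
  have h : HasFDerivAt (fun v : ι → ℝ => ∑ i, c i * v i ^ 2)
      (∑ i, c i • ((2 * a i x) • ContinuousLinearMap.proj (R := ℝ) (φ := fun _ : ι => ℝ) i))
      (fun i => a i x) := by
    refine HasFDerivAt.fun_sum fun i _ => ?_
    have := ((ContinuousLinearMap.proj (R := ℝ) (φ := fun _ : ι => ℝ) i).hasFDerivAt
      (x := fun i => a i x)).pow 2
    simpa using this.const_mul (c i)
  rw [diffAt_comp ha h w]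
  simp
  exact Finset.sum_congr rfl fun i _ => by ring

/-- A function whose differential annihilates the field is constant on every trajectory, the
interval of definition being arbitrary. -/
theorem isFirstIntegral_of_diffAt_eq_zero {X : (x : M) → TangentSpace J x} {a : M → ℝ}
    (ha : ContMDiff J 𝓘(ℝ, ℝ) ∞ a) (h : ∀ x, diffAt J a x (X x) = 0) : IsFirstIntegral J X a := by
  refine ⟨ha, fun γ s hs hγ t ht t' ht' => ?_⟩
  have hd : ∀ r ∈ s, HasDerivWithinAt (fun r => a (γ r)) 0 s r := by
    intro r hr
    have h1 := HasMFDerivAt.comp_hasMFDerivWithinAt r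
      ((ha.mdifferentiableAt (x := γ r) (by simp)).hasMFDerivAt) (hγ r hr)
    obtain ⟨L, hL⟩ : ∃ L : ℝ →L[ℝ] ℝ, L = (mfderiv J 𝓘(ℝ, ℝ) a (γ r) : F →L[ℝ] ℝ).comp
      ((1 : ℝ →L[ℝ] ℝ).smulRight (show F from X (γ r))) := ⟨_, rfl⟩
    have h2 : HasFDerivWithinAt (fun r => a (γ r)) L s r := by
      rw [hL]; exact hasMFDerivWithinAt_iff_hasFDerivWithinAt.1 h1
    refine h2.hasDerivWithinAt.congr_deriv ?_
    rw [hL]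
    have h3 : (mfderiv J 𝓘(ℝ, ℝ) a (γ r) : F →L[ℝ] ℝ) ((1 : ℝ) • (show F from X (γ r))) = 0 := by
      rw [one_smul]; exact h (γ r)
    exact h3
  have := Convex.norm_image_sub_le_of_norm_hasDerivWithin_le (C := 0) hd (by simp)
    hs.convex ht' ht
  simpa [sub_eq_zero] using this
end

/-! ### Diagonal quadratic Hamiltonians -/

section

variable {E : Type*} [NormedAddCommGroup E] [NormedSpace ℝ E]
  {G : Type*} [TopologicalSpace G] [ChartedSpace E G] [IsManifold 𝓘(ℝ, E) ∞ G]

/-- The diagonal quadratic form with coefficients `c` in the functions `a i`. -/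
def quadHam {ι : Type*} [Fintype ι] (c : ι → ℝ) (a : ι → Cotangent E G → ℝ)
    (l : Cotangent E G) : ℝ :=
  ∑ i, c i * a i l ^ 2

theorem contMDiff_quadHam {ι : Type*} [Fintype ι] (c : ι → ℝ) {a : ι → Cotangent E G → ℝ}
    (ha : ∀ i, ContMDiff (cotangentModel E) 𝓘(ℝ, ℝ) ∞ (a i)) :
    ContMDiff (cotangentModel E) 𝓘(ℝ, ℝ) ∞ (quadHam c a) :=
  contMDiff_finsetSum fun i _ => contMDiff_const.mul ((ha i).pow 2)

theorem diffAt_quadHam {ι : Type*} [Fintype ι] (c : ι → ℝ) {a : ι → Cotangent E G → ℝ}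
    (ha : ∀ i, ContMDiff (cotangentModel E) 𝓘(ℝ, ℝ) ∞ (a i)) (l : Cotangent E G)
    (w : TangentSpace (cotangentModel E) l) :
    diffAt (cotangentModel E) (quadHam c a) l w =
      ∑ i, 2 * c i * a i l * diffAt (cotangentModel E) (a i) l w :=
  diffAt_sum_sq c (fun i => (ha i).mdifferentiableAt (by simp)) w

theorem poisson_quadHam_right [FiniteDimensional ℝ E] {ι : Type*} [Fintype ι] (c : ι → ℝ)
    {a : ι → Cotangent E G → ℝ} (ha : ∀ i, ContMDiff (cotangentModel E) 𝓘(ℝ, ℝ) ∞ (a i))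
    (b : Cotangent E G → ℝ) (l : Cotangent E G) :
    poisson b (quadHam c a) l = ∑ i, 2 * c i * a i l * poisson b (a i) l := by
  simp only [poisson_eq_diffAt, diffAt_quadHam c ha]

theorem poisson_quadHam_left [FiniteDimensional ℝ E] {ι : Type*} [Fintype ι] (c : ι → ℝ)
    {a : ι → Cotangent E G → ℝ} (ha : ∀ i, ContMDiff (cotangentModel E) 𝓘(ℝ, ℝ) ∞ (a i))
    (b : Cotangent E G → ℝ) (l : Cotangent E G) :
    poisson (quadHam c a) b l = ∑ i, 2 * c i * a i l * poisson (a i) b l := by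
  rw [poisson_swap, poisson_quadHam_right c ha, ← Finset.sum_neg_distrib]
  exact Finset.sum_congr rfl fun i _ => by rw [poisson_swap (a i) b]; ring

theorem isFirstIntegral_hamiltonianField [FiniteDimensional ℝ E] {a b : Cotangent E G → ℝ}
    (hb : ContMDiff (cotangentModel E) 𝓘(ℝ, ℝ) ∞ b) (h : ∀ l, poisson a b l = 0) :
    IsFirstIntegral (cotangentModel E) (hamiltonianField a) b :=
  isFirstIntegral_of_diffAt_eq_zero hb fun l => (poisson_eq_diffAt a b l).symm.trans (h l)
end

/-! ### Poisson brackets of invariant Hamiltonians -/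

section

variable {E : Type*} [NormedAddCommGroup E] [NormedSpace ℝ E]
  {G : Type*} [TopologicalSpace G] [ChartedSpace E G] [Group G]

theorem leftHam_smul (r : ℝ) (v : GroupLieAlgebra 𝓘(ℝ, E) G) (l : Cotangent E G) :
    leftHam (r • v) l = r * leftHam v l := by
  unfold leftHam pairing
  rw [mulInvariantVectorField_smul]
  exact map_smul (l.snd : E →L[ℝ] ℝ) _ _

theorem rightField_add (u v : GroupLieAlgebra 𝓘(ℝ, E) G) :
    rightField (u + v) = rightField u + rightField v := by
  funext q
  unfold rightField
  rw [mulInvariantVectorField_add, mpullback_add]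

theorem rightField_smul (r : ℝ) (v : GroupLieAlgebra 𝓘(ℝ, E) G) :
    rightField (r • v) = r • rightField v := by
  funext q
  unfold rightField
  rw [mulInvariantVectorField_smul, mpullback_const_smul]

theorem rightHam_add (u v : GroupLieAlgebra 𝓘(ℝ, E) G) (l : Cotangent E G) :
    rightHam (u + v) l = rightHam u l + rightHam v l := by
  unfold rightHam pairing
  rw [rightField_add]
  exact map_add (l.snd : E →L[ℝ] ℝ) _ _

theorem rightHam_smul (r : ℝ) (v : GroupLieAlgebra 𝓘(ℝ, E) G) (l : Cotangent E G) :
    rightHam (r • v) l = r * rightHam v l := by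
  unfold rightHam pairing
  rw [rightField_smul]
  exact map_smul (l.snd : E →L[ℝ] ℝ) _ _

theorem rightCombination_eq_rightHam (α : Fin 3 → ℝ) (f : Fin 3 → GroupLieAlgebra 𝓘(ℝ, E) G) :
    rightCombination α f = rightHam (α 0 • f 0 + α 1 • f 1 + α 2 • f 2) := by
  funext l
  simp only [rightCombination, Fin.sum_univ_three, rightHam_add, rightHam_smul]

variable [LieGroup 𝓘(ℝ, E) ∞ G]

theorem contMDiff_leftHam (v : GroupLieAlgebra 𝓘(ℝ, E) G) :
    ContMDiff (cotangentModel E) 𝓘(ℝ, ℝ) ∞ (leftHam v : Cotangent E G → ℝ) :=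
  contMDiff_fieldHam (contMDiff_leftField v)

theorem contMDiff_rightHam (v : GroupLieAlgebra 𝓘(ℝ, E) G) :
    ContMDiff (cotangentModel E) 𝓘(ℝ, ℝ) ∞ (rightHam v : Cotangent E G → ℝ) :=
  contMDiff_fieldHam (contMDiff_rightField v)

variable [FiniteDimensional ℝ E]

theorem poisson_leftHam_leftHam (u v : GroupLieAlgebra 𝓘(ℝ, E) G) (l : Cotangent E G) :
    poisson (leftHam u) (leftHam v) l = leftHam ⁅u, v⁆ l := by
  refine (poisson_fieldHam (contMDiff_leftField u) (contMDiff_leftField v) l).trans ?_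
  rw [mlieBracket_leftField]
  rfl

theorem poisson_rightHam_rightHam (u v : GroupLieAlgebra 𝓘(ℝ, E) G) (l : Cotangent E G) :
    poisson (rightHam u) (rightHam v) l = rightHam ⁅u, v⁆ l := by
  refine (poisson_fieldHam (contMDiff_rightField u) (contMDiff_rightField v) l).trans ?_
  rw [mlieBracket_rightField]
  rfl

theorem poisson_rightHam_leftHam (u v : GroupLieAlgebra 𝓘(ℝ, E) G) (l : Cotangent E G) :
    poisson (rightHam u) (leftHam v) l = 0 := by
  refine (poisson_fieldHam (contMDiff_rightField u) (contMDiff_leftField v) l).trans ?_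
  rw [mlieBracket_rightField_leftField]
  exact map_zero (l.snd : E →L[ℝ] ℝ)

theorem poisson_leftHam_rightHam (u v : GroupLieAlgebra 𝓘(ℝ, E) G) (l : Cotangent E G) :
    poisson (leftHam u) (rightHam v) l = 0 := by
  rw [poisson_swap, poisson_rightHam_leftHam, neg_zero]

end

/-! ### Functions with vanishing differential -/

section

variable {E : Type*} [NormedAddCommGroup E] [NormedSpace ℝ E]
  {G : Type*} [TopologicalSpace G] [ChartedSpace E G]

/-- On a connected manifold, a function with vanishing differential is constant. -/
theorem eq_of_diffAt_eq_zero [IsManifold 𝓘(ℝ, E) ∞ G] [ConnectedSpace G] {a : G → ℝ}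
    (ha : ContMDiff 𝓘(ℝ, E) 𝓘(ℝ, ℝ) ∞ a) (h : ∀ x v, diffAt 𝓘(ℝ, E) a x v = 0) (x y : G) :
    a x = a y := by
  refine IsLocallyConstant.apply_eq_of_preconnectedSpace
    ((IsLocallyConstant.iff_eventually_eq a).2 fun x => ?_) x y
  set φ := extChartAt 𝓘(ℝ, E) x
  obtain ⟨r, hr, hb⟩ := Metric.mem_nhds_iff.1 (extChartAt_target_mem_nhds (I := 𝓘(ℝ, E)) x)
  have hd : ∀ z ∈ Metric.ball (φ x) r, HasFDerivAt (a ∘ φ.symm) (0 : E →L[ℝ] ℝ) z := by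
    intro z hz
    have h1 : MDifferentiableAt 𝓘(ℝ, E) 𝓘(ℝ, E) φ.symm z := by
      have := mdifferentiableWithinAt_extChartAt_symm (hb hz)
      rwa [ModelWithCorners.range_eq_univ, mdifferentiableWithinAt_univ] at this
    have h2 : mfderiv 𝓘(ℝ, E) 𝓘(ℝ, ℝ) a (φ.symm z) = 0 :=
      ContinuousLinearMap.ext fun v => h (φ.symm z) v
    have h3 := (ha.mdifferentiableAt (x := φ.symm z) (by simp)).hasMFDerivAt
    rw [h2] at h3
    have h4 := HasMFDerivAt.comp z h3 h1.hasMFDerivAt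
    refine hasMFDerivAt_iff_hasFDerivAt.1 ?_
    convert! h4 using 1
  filter_upwards [extChartAt_source_mem_nhds (I := 𝓘(ℝ, E)) x,
    (continuousAt_extChartAt x).eventually (Metric.ball_mem_nhds (φ x) hr)] with y hy₁ hy₂
  have h5 := Metric.isOpen_ball.is_const_of_fderiv_eq_zero (𝕜 := ℝ) (f := a ∘ φ.symm)
    (convex_ball (φ x) r).isPreconnected
    (fun z hz => (hd z hz).differentiableAt.differentiableWithinAt)
    (fun z hz => (hd z hz).fderiv) hy₂ (Metric.mem_ball_self hr)
  rw [Function.comp_apply, Function.comp_apply, φ.left_inv hy₁,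
    φ.left_inv (mem_extChartAt_source x)] at h5
  exact h5

/-! ### Right-invariant fields in the left trivialization -/

/-- If `X` commutes with every `Y i`, then the bracket of `X` with `∑ a i • Y i` differentiates only
the coefficients. -/
theorem mlieBracket_sum_smul_right [FiniteDimensional ℝ E] [IsManifold 𝓘(ℝ, E) ∞ G] {ι : Type*}
    (X : (q : G) → TangentSpace 𝓘(ℝ, E) q) {Y : ι → (q : G) → TangentSpace 𝓘(ℝ, E) q}
    (hY : ∀ i, ContMDiff 𝓘(ℝ, E) 𝓘(ℝ, E).tangent ∞
      (fun q => (Y i q : TangentBundle 𝓘(ℝ, E) G)))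
    (hXY : ∀ i, mlieBracket 𝓘(ℝ, E) X (Y i) = 0)
    {a : ι → G → ℝ} (ha : ∀ i, ContMDiff 𝓘(ℝ, E) 𝓘(ℝ, ℝ) ∞ (a i)) (q : G) (s : Finset ι) :
    mlieBracket 𝓘(ℝ, E) X (∑ i ∈ s, a i • Y i) q =
      ∑ i ∈ s, (diffAt 𝓘(ℝ, E) (a i) q : E →L[ℝ] ℝ) (X q) • Y i q := by
  have := FiniteDimensional.complete ℝ E
  classical
  induction s using Finset.induction_on with
  | empty =>
    rw [Finset.sum_empty, Finset.sum_empty, mlieBracket_zero_right]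
    rfl
  | insert i s hi ih =>
    rw [Finset.sum_insert hi, Finset.sum_insert hi, mlieBracket_add_right, ih,
      mlieBracket_smul_right ((ha i).mdifferentiableAt (by simp))
        ((hY i).mdifferentiableAt (by simp)), hXY i, Pi.zero_apply, smul_zero, add_zero]
    · rfl
    · exact ((ha i).smul_section (hY i)).mdifferentiableAt (by simp)
    · have h := ContMDiff.sum_section (s := s) (t := fun i => a i • Y i)
        fun i _ => (ha i).smul_section (hY i)
      have h' := h.mdifferentiableAt (x := q) (by simp)
      convert! h' using 3
      exact Finset.sum_apply _ _ _

variable [Group G]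

theorem leftTrans_add (q : G) (u v : TangentSpace 𝓘(ℝ, E) q) :
    leftTrans q (u + v) = leftTrans q u + leftTrans q v :=
  map_add (tderiv E (fun x : G => q⁻¹ * x) q) _ _

theorem leftTrans_smul (q : G) (r : ℝ) (v : TangentSpace 𝓘(ℝ, E) q) :
    leftTrans q (r • v) = r • leftTrans q v :=
  map_smul (tderiv E (fun x : G => q⁻¹ * x) q) _ _

/-- The right-invariant field `e_v` in the left trivialization, i.e. `-Ad(q⁻¹) v`. -/
noncomputable def rightCoord (v : GroupLieAlgebra 𝓘(ℝ, E) G) (q : G) : GroupLieAlgebra 𝓘(ℝ, E) G :=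
  leftTrans q (rightField v q)

theorem rightCoord_add (u v : GroupLieAlgebra 𝓘(ℝ, E) G) (q : G) :
    rightCoord (u + v) q = rightCoord u q + rightCoord v q := by
  unfold rightCoord
  rw [rightField_add]
  exact leftTrans_add q _ _

theorem rightCoord_smul (r : ℝ) (v : GroupLieAlgebra 𝓘(ℝ, E) G) (q : G) :
    rightCoord (r • v) q = r • rightCoord v q := by
  unfold rightCoord
  rw [rightField_smul]
  exact leftTrans_smul q _ _

variable [LieGroup 𝓘(ℝ, E) ∞ G]

theorem leftField_rightCoord (v : GroupLieAlgebra 𝓘(ℝ, E) G) (q : G) :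
    mulInvariantVectorField (rightCoord v q) q = rightField v q :=
  leftField_leftTrans q _

theorem contMDiff_apply_rightCoord (ξ : E →L[ℝ] ℝ) (v : GroupLieAlgebra 𝓘(ℝ, E) G) :
    ContMDiff 𝓘(ℝ, E) 𝓘(ℝ, ℝ) ∞ (fun q : G => ξ (rightCoord v q)) :=
  ξ.contMDiff.comp (contMDiff_leftTrans (contMDiff_rightField v))

/-- The inversion has derivative `-1` at the identity, by differentiating `x * x⁻¹ = 1`. -/
theorem tderiv_inv_one (v : E) : tderiv E (fun x : G => x⁻¹) 1 v = -v := by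
  have hF : ContMDiff (𝓘(ℝ, E).prod 𝓘(ℝ, E)) 𝓘(ℝ, E) ∞ (fun z : G × G => z.1 * z.2⁻¹) :=
    contMDiff_fst.mul contMDiff_snd.inv
  have h1 := mfderiv_prod_eq_add_apply (hF.mdifferentiableAt (x := ((1 : G), (1 : G))) (by simp))
    (v := (v, v))
  have h2 := HasMFDerivAt.comp (1 : G) (f := fun x : G => (x, x))
    (hF.mdifferentiableAt (x := ((1 : G), (1 : G))) (by simp)).hasMFDerivAt
    ((hasMFDerivAt_id (I := 𝓘(ℝ, E)) (1 : G)).prodMk (hasMFDerivAt_id (1 : G)))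
  have h3 : ((fun z : G × G => z.1 * z.2⁻¹) ∘ fun x : G => (x, x)) = fun _ => 1 := by
    funext x; simp
  rw [h3] at h2
  have h4 := congrArg (fun L : E →L[ℝ] E => L v)
    (h2.mfderiv.symm.trans (mfderiv_const (I := 𝓘(ℝ, E)) (c := (1 : G)) (x := (1 : G))))
  have h5 : tderiv E (fun z : G => z * 1⁻¹) 1 v = v := by
    simpa using tderiv_id E (1 : G) v
  have h6 : tderiv E (fun z : G => 1 * z⁻¹) 1 v = tderiv E (fun x : G => x⁻¹) 1 v := by
    simp
  have h8 : tderiv E (fun z : G => z * 1⁻¹) 1 v + tderiv E (fun z : G => 1 * z⁻¹) 1 v = 0 :=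
    h1.symm.trans h4
  rw [h5, h6] at h8
  exact eq_neg_of_add_eq_zero_right h8

theorem rightCoord_one (v : GroupLieAlgebra 𝓘(ℝ, E) G) : rightCoord v (1 : G) = -v := by
  have h1 : (rightField v (1 : G) : E) = -v := by
    rw [rightField_eq]
    simp only [mul_one]
    exact tderiv_inv_one (E := E) (G := G) v
  have h2 := leftField_rightCoord v (1 : G)
  have h3 : (mulInvariantVectorField (rightCoord v (1 : G)) (1 : G) : E) =
      rightCoord v (1 : G) := by
    rw [leftField_eq]
    simp only [one_mul]
    exact tderiv_id E (1 : G) (rightCoord v (1 : G) : E)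
  exact h3.symm.trans (h2.trans h1)

theorem rightCoord_injective (q : G) : Function.Injective
    (fun v : GroupLieAlgebra 𝓘(ℝ, E) G => rightCoord v q) := by
  intro u v huv
  have h : (rightField u q : E) = rightField v q := by
    have h1 := leftField_rightCoord u q
    have h2 := leftField_rightCoord v q
    rw [← h1, ← h2]
    exact congrArg (fun w => mulInvariantVectorField w q) huv
  rw [rightField_eq, rightField_eq] at h
  have key : ∀ w : E, tderiv E (fun x : G => q * x⁻¹) q (tderiv E (fun x : G => x⁻¹ * q) 1 w) = w :=
    fun w => (tderiv_tderiv E (k := fun x => x) (contMDiff_const.mul (contMDiff_inv 𝓘(ℝ, E) ∞))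
      ((contMDiff_inv 𝓘(ℝ, E) ∞).mul contMDiff_const) (by simp) (by simp) w).trans (tderiv_id E 1 w)
  exact (key u).symm.trans ((congrArg _ h).trans (key v))

theorem rightField_surjective (q : G) (w : TangentSpace 𝓘(ℝ, E) q) :
    ∃ v : GroupLieAlgebra 𝓘(ℝ, E) G, rightField v q = w := by
  refine ⟨tderiv E (fun x : G => q * x⁻¹) q w, ?_⟩
  have h := rightField_eq (tderiv E (fun x : G => q * x⁻¹) q w) q
  refine h.trans ?_
  exact (tderiv_tderiv E (k := fun x => x) ((contMDiff_inv 𝓘(ℝ, E) ∞).mul contMDiff_const)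
    (contMDiff_const.mul (contMDiff_inv 𝓘(ℝ, E) ∞)) (by simp) (by simp) (w : E)).trans
    (tderiv_id E q w)

/-- Along the right-invariant field of `u`, the left coordinates of the right-invariant field of `v`
change by those of the right-invariant field of `⁅u, v⁆`: expand the latter field in left-invariant
ones, with which the field of `u` commutes. -/
theorem diffAt_apply_rightCoord [FiniteDimensional ℝ E] (ξ : E →L[ℝ] ℝ)
    (u v : GroupLieAlgebra 𝓘(ℝ, E) G) (q : G) :
    diffAt 𝓘(ℝ, E) (fun q : G => ξ (rightCoord v q)) q (rightField u q) =
      ξ (rightCoord ⁅u, v⁆ q) := by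
  set b := Module.finBasis ℝ E
  let c : Fin (Module.finrank ℝ E) → E →L[ℝ] ℝ := fun i => (b.coord i).toContinuousLinearMap
  have hT : ∀ (T : E →L[ℝ] E) (r : Fin (Module.finrank ℝ E) → ℝ)
      (y : Fin (Module.finrank ℝ E) → E), T (∑ i, r i • y i) = ∑ i, r i • T (y i) := by
    intro T r y; simp
  have hc : ∀ x : E, ∑ i, c i x • b i = x := fun x => b.sum_repr x
  let a : Fin (Module.finrank ℝ E) → G → ℝ := fun i q => c i (rightCoord v q)
  have ha : ∀ i, ContMDiff 𝓘(ℝ, E) 𝓘(ℝ, ℝ) ∞ (a i) := fun i => contMDiff_apply_rightCoord (c i) v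
  let B : Fin (Module.finrank ℝ E) → GroupLieAlgebra 𝓘(ℝ, E) G := fun i => b i
  have h1 : rightField v =
      ∑ i, a i • (mulInvariantVectorField (B i) : (q : G) → TangentSpace 𝓘(ℝ, E) q) := by
    funext p
    rw [Finset.sum_apply, ← leftField_rightCoord]
    exact ((hT (tderiv E (fun x : G => p * x) 1) (fun i => a i p) b).symm.trans
      (congrArg (tderiv E (fun x : G => p * x) 1) (hc (rightCoord v p)))).symm
  have h2 := mlieBracket_sum_smul_right (rightField u) (fun i => contMDiff_leftField (B i))
    (fun i => mlieBracket_rightField_leftField u (B i)) ha q Finset.univ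
  rw [← h1, mlieBracket_rightField] at h2
  have h3 := (congrArg (tderiv E (fun x : G => q⁻¹ * x) q) h2).trans (hT _
    (fun i => (diffAt 𝓘(ℝ, E) (a i) q : E →L[ℝ] ℝ) (rightField u q)) fun i =>
      mulInvariantVectorField (B i) q)
  have h4 : (rightCoord ⁅u, v⁆ q : E) =
      ∑ i, (diffAt 𝓘(ℝ, E) (a i) q : E →L[ℝ] ℝ) (rightField u q) • b i :=
    h3.trans (Finset.sum_congr rfl fun i _ => congrArg _ (leftTrans_leftField q (B i)))
  obtain ⟨L, hL⟩ : ∃ L : (Fin (Module.finrank ℝ E) → ℝ) →L[ℝ] ℝ,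
      ∀ r : Fin (Module.finrank ℝ E) → ℝ, L r = ξ (∑ i, r i • b i) :=
    ⟨∑ i, ξ (b i) • ContinuousLinearMap.proj (R := ℝ) (φ := fun _ => ℝ) i, fun r => by
      simp [mul_comm]⟩
  have h5 : (fun p : G => ξ (rightCoord v p)) = fun p => L fun i => a i p := by
    funext p
    exact (congrArg ξ (hc (rightCoord v p)).symm).trans (hL fun i => a i p).symm
  rw [h5]
  exact (diffAt_comp (fun i => (ha i).mdifferentiableAt (by simp))
    L.hasFDerivAt _).trans ((hL _).trans (congrArg ξ h4).symm)

end

/-! ### Frames of unimodular contact structures and the Casimir function -/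

section

variable {E : Type*} [NormedAddCommGroup E] [NormedSpace ℝ E]
  {G : Type*} [TopologicalSpace G] [ChartedSpace E G] [Group G]

/-- A frame spanning the Lie algebra with the structure constants of a unimodular contact
sub-Riemannian structure. -/
structure IsUnimodularFrame (f : Fin 3 → GroupLieAlgebra 𝓘(ℝ, E) G) (χ κ : ℝ) : Prop where
  span_eq_top : Submodule.span ℝ (range f) = ⊤
  bracket_two_one : ⁅f 2, f 1⁆ = f 0
  bracket_one_zero : ⁅f 1, f 0⁆ = (χ + κ) • f 2
  bracket_two_zero : ⁅f 2, f 0⁆ = (χ - κ) • f 1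

/-- The coefficients of the Casimir function `2 (ξ₀² + (κ - χ) ξ₁² + (κ + χ) ξ₂²)` as a diagonal
quadratic form. -/
def casimirCoeff (χ κ : ℝ) : Fin 3 → ℝ := ![2, 2 * (κ - χ), 2 * (κ + χ)]

variable {f : Fin 3 → GroupLieAlgebra 𝓘(ℝ, E) G} {χ κ : ℝ}

theorem IsUnimodularFrame.exists_eq (hf : IsUnimodularFrame f χ κ) (v : GroupLieAlgebra 𝓘(ℝ, E) G) :
    ∃ r : Fin 3 → ℝ, v = r 0 • f 0 + r 1 • f 1 + r 2 • f 2 := by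
  have hv : v ∈ Submodule.span ℝ (range f) := hf.span_eq_top ▸ Submodule.mem_top
  obtain ⟨r, hr⟩ := (Submodule.mem_span_range_iff_exists_fun ℝ).1 hv
  exact ⟨r, by rw [← hr, Fin.sum_univ_three]⟩

/-- The gradient at `ξ` of the Casimir function `∑ i, c i * ξ (F i) ^ 2`. -/
noncomputable def casimirGradient (χ κ : ℝ) (ξ : E →L[ℝ] ℝ) (F : Fin 3 → E) : E :=
  ∑ i, (2 * casimirCoeff χ κ i * ξ (F i)) • F i

/-- A continuous functional on the model space `E` as a linear functional on the Lie algebra, whose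
underlying space is `E` but which carries no norm. -/
def toLin (ξ : E →L[ℝ] ℝ) : GroupLieAlgebra 𝓘(ℝ, E) G →ₗ[ℝ] ℝ := ξ.toLinearMap

/-- `rightCoord`, at a fixed point `q`, as a linear endomorphism of the Lie algebra. -/
noncomputable def rightCoordLinear (q : G) :
    GroupLieAlgebra 𝓘(ℝ, E) G →ₗ[ℝ] GroupLieAlgebra 𝓘(ℝ, E) G where
  toFun v := rightCoord v q
  map_add' u v := rightCoord_add u v q
  map_smul' r v := rightCoord_smul r v q

/-- The left trivialization of `T*G`: the covector `l` moved to the identity by the left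
translation, so that `leftHam v l = leftFunctional l v` by definition. -/
noncomputable def leftFunctional (l : Cotangent E G) : E →L[ℝ] ℝ :=
  (l.snd : E →L[ℝ] ℝ).comp (tderiv E (fun x => l.proj * x) 1)

variable [LieGroup 𝓘(ℝ, E) ∞ G]

theorem rightHam_eq_leftFunctional (v : GroupLieAlgebra 𝓘(ℝ, E) G) (l : Cotangent E G) :
    rightHam v l = leftFunctional l (rightCoord v l.proj) :=
  congrArg (l.snd : E →L[ℝ] ℝ) (leftField_rightCoord v l.proj).symm

variable [FiniteDimensional ℝ E]

/-! The bracket of left-invariant fields is defined on any smooth group, but the Lie algebra laws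
are available for groups of class `minSmoothness ℝ 3`; they are transferred here to the class `∞`.
-/

theorem bracket_skew (u v : GroupLieAlgebra 𝓘(ℝ, E) G) : -⁅v, u⁆ = ⁅u, v⁆ := by
  have := FiniteDimensional.complete ℝ E
  have := lieGroup_minSmoothness (E := E) (G := G)
  exact lie_skew u v

theorem bracket_self (u : GroupLieAlgebra 𝓘(ℝ, E) G) : ⁅u, u⁆ = 0 := by
  have := FiniteDimensional.complete ℝ E
  have := lieGroup_minSmoothness (E := E) (G := G)
  exact lie_self u

theorem bracket_add (u v w : GroupLieAlgebra 𝓘(ℝ, E) G) : ⁅u, v + w⁆ = ⁅u, v⁆ + ⁅u, w⁆ := by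
  have := FiniteDimensional.complete ℝ E
  have := lieGroup_minSmoothness (E := E) (G := G)
  exact lie_add u v w

theorem bracket_smul (r : ℝ) (u v : GroupLieAlgebra 𝓘(ℝ, E) G) : ⁅u, r • v⁆ = r • ⁅u, v⁆ := by
  have := FiniteDimensional.complete ℝ E
  have := lieGroup_minSmoothness (E := E) (G := G)
  exact lie_smul r u v

theorem add_bracket (u v w : GroupLieAlgebra 𝓘(ℝ, E) G) : ⁅u + v, w⁆ = ⁅u, w⁆ + ⁅v, w⁆ := by
  have := FiniteDimensional.complete ℝ E
  have := lieGroup_minSmoothness (E := E) (G := G)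
  exact add_lie u v w

theorem smul_bracket (r : ℝ) (u v : GroupLieAlgebra 𝓘(ℝ, E) G) : ⁅r • u, v⁆ = r • ⁅u, v⁆ := by
  have := FiniteDimensional.complete ℝ E
  have := lieGroup_minSmoothness (E := E) (G := G)
  exact smul_lie r u v

/-- The contact condition: brackets of fields tangent to `Δ` are multiples of `f 0 = ⁅f 2, f 1⁆`, so
`f 0`, `f 1`, `f 2` span the Lie algebra. -/
theorem ContactSR.span_frame_eq_top (S : ContactSR E G) (f : Fin 3 → GroupLieAlgebra 𝓘(ℝ, E) G)
    (hS : S.plane = Submodule.span ℝ {f 1, f 2}) (h : ⁅f 2, f 1⁆ = f 0) :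
    Submodule.span ℝ (range f) = ⊤ := by
  have hf : ∀ i, f i ∈ Submodule.span ℝ (range f) := fun i => Submodule.subset_span ⟨i, rfl⟩
  rw [eq_top_iff, ← S.contact, sup_le_iff, Submodule.span_le]
  refine ⟨?_, ?_⟩
  · rw [hS, Submodule.span_le]
    rintro _ (rfl | rfl)
    exacts [hf 1, hf 2]
  · rintro _ ⟨x, hx, y, hy, rfl⟩
    rw [hS, Submodule.mem_span_pair] at hx hy
    obtain ⟨a, b, rfl⟩ := hx
    obtain ⟨c, d, rfl⟩ := hy
    have : ⁅a • f 1 + b • f 2, c • f 1 + d • f 2⁆ = (b * c - a * d) • f 0 := by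
      simp only [bracket_add, bracket_smul, add_bracket, smul_bracket, bracket_self, h,
        ← bracket_skew (f 1) (f 2)]
      module
    rw [this]
    exact Submodule.smul_mem _ _ (hf 0)

/-- The Casimir property at the level of the Lie algebra: `⟨ξ, [d_ξ C, v]⟩ = 0` for all `v`. -/
theorem IsUnimodularFrame.sum_casimirCoeff_mul (hf : IsUnimodularFrame f χ κ)
    (ξ : GroupLieAlgebra 𝓘(ℝ, E) G →ₗ[ℝ] ℝ) (v : GroupLieAlgebra 𝓘(ℝ, E) G) :
    ∑ i, 2 * casimirCoeff χ κ i * ξ (f i) * ξ ⁅f i, v⁆ = 0 := by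
  obtain ⟨r, rfl⟩ := hf.exists_eq v
  simp only [Fin.sum_univ_three, casimirCoeff, bracket_add, bracket_smul, bracket_self,
    ← bracket_skew (f 0) (f 1), ← bracket_skew (f 0) (f 2), ← bracket_skew (f 1) (f 2),
    hf.bracket_two_one, hf.bracket_one_zero, hf.bracket_two_zero, map_add, map_smul, map_neg,
    map_zero, smul_eq_mul, Matrix.cons_val]
  ring

/-- The Casimir function is invariant under the coadjoint action: its value on `ξ ∘ Ad(q⁻¹)` has
zero derivative along all right-invariant fields, hence is constant in `q` on a connected group.
The sign in `rightCoord v 1 = -v` disappears in the squares. -/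
theorem IsUnimodularFrame.quad_rightCoord_eq [ConnectedSpace G] (hf : IsUnimodularFrame f χ κ)
    (ξ : E →L[ℝ] ℝ) (q : G) :
    ∑ i, casimirCoeff χ κ i * ξ (rightCoord (f i) q) ^ 2 =
      ∑ i, casimirCoeff χ κ i * ξ (f i) ^ 2 := by
  have hs : ∀ i, ContMDiff 𝓘(ℝ, E) 𝓘(ℝ, ℝ) ∞ (fun q : G => ξ (rightCoord (f i) q)) :=
    fun i => contMDiff_apply_rightCoord ξ (f i)
  refine (eq_of_diffAt_eq_zero
    (a := fun q : G => ∑ i, casimirCoeff χ κ i * ξ (rightCoord (f i) q) ^ 2)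
    (contMDiff_finsetSum fun i _ => contMDiff_const.mul ((hs i).pow 2)) ?_ q 1).trans ?_
  · intro q w
    obtain ⟨u, rfl⟩ := rightField_surjective q w
    refine (diffAt_sum_sq _ (fun i => (hs i).mdifferentiableAt (by simp)) _).trans ?_
    have h := hf.sum_casimirCoeff_mul ((toLin ξ).comp (rightCoordLinear q)) u
    rw [← neg_eq_zero, ← Finset.sum_neg_distrib] at h
    refine Eq.trans (Finset.sum_congr rfl fun i _ => ?_) h
    rw [diffAt_apply_rightCoord, ← bracket_skew (f i) u, map_neg, mul_neg, neg_neg]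
    rfl
  · refine Finset.sum_congr rfl fun i _ => ?_
    have h : ξ (rightCoord (f i) (1 : G)) = - ξ (f i) :=
      (congrArg ξ (rightCoord_one (f i))).trans (map_neg ξ _)
    rw [h, neg_sq]

/-- The Casimir function takes the same value on the left and on the right momenta of a covector. -/
theorem IsUnimodularFrame.quadHam_leftHam_eq [ConnectedSpace G] (hf : IsUnimodularFrame f χ κ) :
    quadHam (casimirCoeff χ κ) (fun i => (leftHam (f i) : Cotangent E G → ℝ)) =
      quadHam (casimirCoeff χ κ) (fun i => rightHam (f i)) := by
  funext l
  simp only [quadHam, rightHam_eq_leftFunctional]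
  exact (hf.quad_rightCoord_eq (leftFunctional l) l.proj).symm

theorem IsUnimodularFrame.isCasimir (hf : IsUnimodularFrame f χ κ) :
    IsCasimir G (fun ξ : E →L[ℝ] ℝ => ∑ i, casimirCoeff χ κ i * ξ (f i) ^ 2) := by
  set F : Fin 3 → E := f with hF
  have hd : ∀ ξ η : E →L[ℝ] ℝ,
      fderiv ℝ (fun ξ : E →L[ℝ] ℝ => ∑ i, casimirCoeff χ κ i * ξ (F i) ^ 2) ξ η =
        η (casimirGradient χ κ ξ F) := by
    intro ξ η
    have h : HasFDerivAt (fun ξ : E →L[ℝ] ℝ => ∑ i, casimirCoeff χ κ i * ξ (F i) ^ 2)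
        (∑ i, casimirCoeff χ κ i • ((2 * ξ (F i)) • ContinuousLinearMap.apply ℝ ℝ (F i))) ξ := by
      refine HasFDerivAt.fun_sum fun i _ => ?_
      have := ((ContinuousLinearMap.apply ℝ ℝ (F i)).hasFDerivAt (x := ξ)).pow 2
      simpa using this.const_mul (casimirCoeff χ κ i)
    rw [h.fderiv]
    simp [casimirGradient]
    exact Finset.sum_congr rfl fun i _ => by ring
  refine ⟨?_, fun a _ ξ => ?_⟩
  · exact ContDiff.sum fun i _ => contDiff_const.mul
      ((ContinuousLinearMap.apply ℝ ℝ (F i)).contDiff.pow 2)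
  · have h1 : dualGradient (fun ξ : E →L[ℝ] ℝ => ∑ i, casimirCoeff χ κ i * ξ (F i) ^ 2) ξ =
        casimirGradient χ κ ξ F := by
      refine (SeparatingDual.eq_iff_forall_dual_eq (R := ℝ)).2 fun η => ?_
      rw [apply_dualGradient, hd]
    have h2 := hf.sum_casimirCoeff_mul (toLin ξ) (dualGradient (E := E) a ξ)
    unfold liePoisson
    refine Eq.trans ?_ h2
    have h3 : ∀ x y : GroupLieAlgebra 𝓘(ℝ, E) G,
        x = ∑ i, (2 * casimirCoeff χ κ i * ξ (F i)) • f i →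
          toLin ξ ⁅x, y⁆ = ∑ i, 2 * casimirCoeff χ κ i * toLin ξ (f i) * toLin ξ ⁅f i, y⁆ := by
      rintro _ y rfl
      rw [Fin.sum_univ_three, Fin.sum_univ_three, add_bracket, add_bracket, smul_bracket,
        smul_bracket, smul_bracket]
      simp only [map_add, map_smul]
      rfl
    exact h3 _ _ h1

end

/-! ### Generic functionals -/

section

variable {E : Type*} [NormedAddCommGroup E] [NormedSpace ℝ E]

theorem dense_setOf_dual_apply_ne_zero {x : E} (hx : x ≠ 0) :
    Dense {ξ : E →L[ℝ] ℝ | ξ x ≠ 0} := by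
  obtain ⟨η, hη⟩ := SeparatingDual.exists_ne_zero (R := ℝ) hx
  have h : interior (LinearMap.ker (ContinuousLinearMap.apply ℝ ℝ x).toLinearMap :
      Set (E →L[ℝ] ℝ)) = ∅ := by
    by_contra hne
    have := Submodule.eq_top_of_nonempty_interior' _ (nonempty_iff_ne_empty.2 hne)
    have hmem : η ∈ LinearMap.ker (ContinuousLinearMap.apply ℝ ℝ x).toLinearMap :=
      this ▸ Submodule.mem_top
    exact hη (by simpa using hmem)
  exact interior_eq_empty_iff_dense_compl.1 h

theorem isOpen_setOf_dual_apply_ne_zero (x : E) : IsOpen {ξ : E →L[ℝ] ℝ | ξ x ≠ 0} :=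
  isOpen_ne_fun (ContinuousLinearMap.apply ℝ ℝ x).continuous continuous_const

/-- For `ξ` outside a hyperplane, the gradient of the Casimir function is not parallel to the given
vector `w`. The hyperplane is the zero set of the minor formed by the coordinates `k` and `m`. -/
theorem exists_forall_linearIndependent_casimirGradient {χ κ : ℝ} (b : Module.Basis (Fin 3) ℝ E)
    (w : E) {k m : Fin 3} (hkm : k ≠ m) (hk : casimirCoeff χ κ k ≠ 0) (hm : b.coord m w ≠ 0) :
    ∃ z : E, z ≠ 0 ∧ ∀ ξ : E →L[ℝ] ℝ, ξ z ≠ 0 →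
      LinearIndependent ℝ ![casimirGradient χ κ ξ b, w] := by
  set c := casimirCoeff χ κ
  refine ⟨(c k * b.coord m w) • b k - (c m * b.coord k w) • b m, fun h => ?_, fun ξ hξ => ?_⟩
  · have := congrArg (b.coord k) h
    simp [hkm] at this
    tauto
  · rw [LinearIndependent.pair_iff]
    intro s t hst
    have hA : ∀ i, b.coord i (casimirGradient χ κ ξ b) = 2 * c i * ξ (b i) := by
      intro i
      simp [casimirGradient, c, Finsupp.single_apply]
    have h1 := congrArg (b.coord k) hst
    have h2 := congrArg (b.coord m) hst
    rw [map_add, map_smul, map_smul, map_zero, hA, smul_eq_mul, smul_eq_mul] at h1 h2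
    rw [map_sub, map_smul, map_smul, smul_eq_mul, smul_eq_mul] at hξ
    have hs : s = 0 := by
      have : s * (c k * b.coord m w * ξ (b k) - c m * b.coord k w * ξ (b m)) = 0 := by
        linear_combination (1 / 2) * b.coord m w * h1 - (1 / 2) * b.coord k w * h2
      exact (mul_eq_zero.1 this).resolve_right hξ
    refine ⟨hs, ?_⟩
    rw [hs] at h2
    have : t * b.coord m w = 0 := by linarith
    exact (mul_eq_zero.1 this).resolve_right hm
end

/-! ### Functional independence on an open dense set -/

section

variable {E : Type*} [NormedAddCommGroup E] [NormedSpace ℝ E]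
  {G : Type*} [TopologicalSpace G] [ChartedSpace E G] [Group G]
  {f : Fin 3 → GroupLieAlgebra 𝓘(ℝ, E) G} {χ κ : ℝ}

theorem IsUnimodularFrame.exists_basis (hf : IsUnimodularFrame f χ κ)
    (hE : Module.finrank ℝ E = 3) : ∃ b : Module.Basis (Fin 3) ℝ E, ⇑b = (f : Fin 3 → E) := by
  have h : ⊤ ≤ Submodule.span ℝ (range (f : Fin 3 → E)) := hf.span_eq_top.ge
  exact ⟨basisOfTopLeSpanOfCardEqFinrank _ h (by simp [hE]),
    coe_basisOfTopLeSpanOfCardEqFinrank _ h _⟩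

theorem geodesicHam_eq_quadHam : (geodesicHam f : Cotangent E G → ℝ) =
    quadHam ![0, 1 / 2, 1 / 2] (fun i => leftHam (f i)) := by
  funext l
  simp [geodesicHam, quadHam, Fin.sum_univ_three]
  ring

theorem pendulumEnergy_eq_quadHam : (pendulumEnergy χ f : Cotangent E G → ℝ) =
    quadHam ![2, -2 * χ, 2 * χ] (fun i => leftHam (f i)) := by
  funext l
  simp [pendulumEnergy, quadHam, Fin.sum_univ_three]
  ring

theorem casimirLeft_eq_quadHam : (casimirLeft χ κ f : Cotangent E G → ℝ) =
    quadHam (casimirCoeff χ κ) (fun i => leftHam (f i)) := by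
  funext l
  simp [casimirLeft, geodesicHam, pendulumEnergy, quadHam, casimirCoeff, Fin.sum_univ_three]
  ring

theorem casimirRight_eq_quadHam : (casimirRight χ κ f : Cotangent E G → ℝ) =
    quadHam (casimirCoeff χ κ) (fun i => rightHam (f i)) := by
  funext l
  simp [casimirRight, quadHam, casimirCoeff, Fin.sum_univ_three]
  ring

variable [LieGroup 𝓘(ℝ, E) ∞ G]

theorem leftTrans_tderiv (q : G) (x : E) : tderiv E (fun y : G => q⁻¹ * y) q
    (tderiv E (fun y : G => q * y) 1 x) = x :=
  leftTrans_leftField q x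

theorem contMDiff_geodesicHam :
    ContMDiff (cotangentModel E) 𝓘(ℝ, ℝ) ∞ (geodesicHam f : Cotangent E G → ℝ) :=
  geodesicHam_eq_quadHam (f := f) ▸ contMDiff_quadHam _ fun i => contMDiff_leftHam (f i)

theorem contMDiff_pendulumEnergy :
    ContMDiff (cotangentModel E) 𝓘(ℝ, ℝ) ∞ (pendulumEnergy χ f : Cotangent E G → ℝ) :=
  pendulumEnergy_eq_quadHam (f := f) ▸ contMDiff_quadHam _ fun i => contMDiff_leftHam (f i)

variable [FiniteDimensional ℝ E]

/-- A functional `γ` on the Lie algebra gives a vertical tangent vector of `T*G`, the derivative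
of the momenta along which is `γ`, in the left trivialization. -/
theorem exists_vertical_diffAt_eq (l : Cotangent E G) (γ : E →L[ℝ] ℝ) :
    ∃ w : TangentSpace (cotangentModel E) l,
      (∀ v, diffAt (cotangentModel E) (leftHam v) l w = γ v) ∧
        ∀ v, diffAt (cotangentModel E) (rightHam v) l w = γ (rightCoord v l.proj) := by
  let β : E →L[ℝ] ℝ := γ.comp (tderiv E (fun x : G => l.proj⁻¹ * x) l.proj)
  have h0 : ∀ L : E →L[ℝ] E, (l.snd : E →L[ℝ] ℝ) (L 0) = 0 := fun L =>
    (congrArg (l.snd : E →L[ℝ] ℝ) (map_zero L)).trans (map_zero (l.snd : E →L[ℝ] ℝ))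
  refine ⟨((0, β) : E × (E →L[ℝ] ℝ)), fun v => ?_, fun v => ?_⟩
  · refine (diffAt_fieldHam (contMDiff_leftField v) l (0, β)).trans ?_
    refine (congrArg₂ (· + ·) rfl (h0 _)).trans ((add_zero _).trans ?_)
    exact congrArg γ (leftTrans_leftField l.proj v)
  · refine (diffAt_fieldHam (contMDiff_rightField v) l (0, β)).trans ?_
    exact (congrArg₂ (· + ·) rfl (h0 _)).trans (add_zero _)

/-- Independence of `H`, `E`, `g` at a covector. In a relation `c₀ dH + c₁ dE + c₂ dg = 0`, the
Hamiltonian field of `h₂` gives `c₀ = 4 κ c₁`; thus `c₁ dC + c₂ dg = 0` with the Casimir function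
`C`, and vertical vectors turn this into a relation between the gradient of `C` and the value of
the right-invariant field of `v`. -/
theorem IsUnimodularFrame.linearIndependent_diffAt (hf : IsUnimodularFrame f χ κ)
    (v : GroupLieAlgebra 𝓘(ℝ, E) G) (l : Cotangent E G) (h0 : leftHam (f 0) l ≠ 0)
    (h1 : leftHam (f 1) l ≠ 0)
    (h : LinearIndependent ℝ ![casimirGradient χ κ (leftFunctional l) f, rightCoord v l.proj]) :
    LinearIndependent ℝ (fun i => diffAt (cotangentModel E)
      (![geodesicHam f, pendulumEnergy χ f, rightHam v] i) l) := by
  have hl := fun i => contMDiff_leftHam (f i)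
  rw [Fintype.linearIndependent_iff]
  intro c hc
  have hw : ∀ w : TangentSpace (cotangentModel E) l,
      c 0 * diffAt (cotangentModel E) (geodesicHam f) l w +
        c 1 * diffAt (cotangentModel E) (pendulumEnergy χ f) l w +
        c 2 * diffAt (cotangentModel E) (rightHam v) l w = 0 := by
    intro w
    rw [Fin.sum_univ_three] at hc
    exact congrArg (fun L : E × (E →L[ℝ] ℝ) →L[ℝ] ℝ => L w) hc
  -- The flow of `h₂` separates `dH` and `dE` and annihilates `dg`.
  have h2 := hw (hamiltonianField (leftHam (f 2)) l)
  rw [← poisson_eq_diffAt, ← poisson_eq_diffAt, ← poisson_eq_diffAt, poisson_leftHam_rightHam,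
    geodesicHam_eq_quadHam, pendulumEnergy_eq_quadHam, poisson_quadHam_right _ hl,
    poisson_quadHam_right _ hl] at h2
  simp only [Fin.sum_univ_three, poisson_leftHam_leftHam, bracket_self, hf.bracket_two_one,
    hf.bracket_two_zero, leftHam_smul, Matrix.cons_val] at h2
  have hz : leftHam (0 : GroupLieAlgebra 𝓘(ℝ, E) G) l = 0 := by
    simpa using leftHam_smul 0 (0 : GroupLieAlgebra 𝓘(ℝ, E) G) l
  rw [hz] at h2
  have hc0 : c 0 = 4 * κ * c 1 := by
    have : (c 0 - 4 * κ * c 1) * (leftHam (f 0) l * leftHam (f 1) l) = 0 := by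
      linear_combination h2
    exact sub_eq_zero.1 ((mul_eq_zero.1 this).resolve_right (mul_ne_zero h0 h1))
  have h3 : c 1 • casimirGradient χ κ (leftFunctional l) f +
      c 2 • (show E from rightCoord v l.proj) = 0 := by
    refine (SeparatingDual.eq_zero_iff_forall_dual_eq_zero (R := ℝ) (V := E) _).2 fun γ => ?_
    obtain ⟨w, hw1, hw2⟩ := exists_vertical_diffAt_eq l γ
    have h4 := hw w
    rw [geodesicHam_eq_quadHam, pendulumEnergy_eq_quadHam, diffAt_quadHam _ hl,
      diffAt_quadHam _ hl, hw2] at h4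
    simp only [Fin.sum_univ_three, hw1, Matrix.cons_val] at h4
    have h5 : γ (casimirGradient χ κ (leftFunctional l) f) =
        ∑ i, 2 * casimirCoeff χ κ i * leftHam (f i) l * γ (f i) := by
      unfold casimirGradient
      rw [map_sum]
      exact Finset.sum_congr rfl fun i _ => map_smul γ _ _
    rw [map_add, map_smul, map_smul, h5]
    simp only [Fin.sum_univ_three, casimirCoeff, Matrix.cons_val, smul_eq_mul]
    linear_combination h4 - (leftHam (f 1) l * γ (f 1) + leftHam (f 2) l * γ (f 2)) * hc0
  obtain ⟨hc1, hc2⟩ := LinearIndependent.pair_iff.1 h _ _ h3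
  intro i
  fin_cases i
  · exact hc0.trans (by rw [hc1, mul_zero])
  · exact hc1
  · exact hc2

/-- On each fibre of `T*G`, the covectors satisfying the three open conditions of
`IsUnimodularFrame.linearIndependent_diffAt` contain the complement of three hyperplanes, so they
are dense already within the fibre. -/
theorem IsUnimodularFrame.functionallyIndependent (hf : IsUnimodularFrame f χ κ)
    {b : Module.Basis (Fin 3) ℝ E} (hb : ⇑b = (f : Fin 3 → E)) (v : GroupLieAlgebra 𝓘(ℝ, E) G)
    (h : ∀ q : G, ∃ k m, k ≠ m ∧ casimirCoeff χ κ k ≠ 0 ∧ b.coord m (rightCoord v q) ≠ 0) :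
    FunctionallyIndependent (cotangentModel E)
      ![geodesicHam f, pendulumEnergy χ f, rightHam v] := by
  refine ⟨{l | leftHam (f 0) l ≠ 0} ∩ {l | leftHam (f 1) l ≠ 0} ∩
    {l | LinearIndependent ℝ ![casimirGradient χ κ (leftFunctional l) f, rightCoord v l.proj]},
    ?_, ?_, fun l hl => hf.linearIndependent_diffAt v l hl.1.1 hl.1.2 hl.2⟩
  · have hl : ∀ i, Continuous (leftHam (f i) : Cotangent E G → ℝ) :=
      fun i => (contMDiff_leftHam (f i)).continuous
    refine ((isOpen_ne_fun (hl 0) continuous_const).inter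
      (isOpen_ne_fun (hl 1) continuous_const)).inter
      (isOpen_setOfPred_linearIndependent.preimage (continuous_pi fun i => ?_))
    fin_cases i
    · have hF : ∀ F : Fin 3 → E, Continuous (fun l : Cotangent E G =>
          ∑ i, (2 * casimirCoeff χ κ i * leftHam (f i) l) • F i) :=
        fun F => continuous_finsetSum _ fun i _ => (continuous_const.mul (hl i)).smul
          continuous_const
      exact hF f
    · exact (contMDiff_leftTrans (contMDiff_rightField v)).continuous.comp
        (FiberBundle.continuous_proj (E →L[ℝ] ℝ)
          (fun q : G => TangentSpace 𝓘(ℝ, E) q →L[ℝ] Trivial G ℝ q))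
  · intro l
    obtain ⟨k, m, hkm, hk, hm⟩ := h l.proj
    obtain ⟨z, hz, hzξ⟩ := exists_forall_linearIndependent_casimirGradient b _ hkm hk hm
    let T : E →L[ℝ] E := tderiv E (fun x => l.proj * x) 1
    have hT : ∀ x : E, x ≠ 0 → T x ≠ 0 := by
      intro x hx hTx
      refine hx ((leftTrans_tderiv l.proj x).symm.trans ?_)
      exact (congrArg _ hTx).trans (map_zero _)
    have hne : ∀ i, (f i : E) ≠ 0 := fun i => by
      have := b.ne_zero i
      rwa [hb] at this
    have hD := ((dense_setOf_dual_apply_ne_zero (hT _ (hne 0))).inter_of_isOpen_left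
      (dense_setOf_dual_apply_ne_zero (hT _ (hne 1)))
      (isOpen_setOf_dual_apply_ne_zero _)).inter_of_isOpen_right
      (dense_setOf_dual_apply_ne_zero (hT z hz)) (isOpen_setOf_dual_apply_ne_zero _)
    have hι : Continuous (fun ξ : E →L[ℝ] ℝ => (⟨l.proj, ξ⟩ : Cotangent E G)) :=
      FiberBundle.continuous_totalSpaceMk (E →L[ℝ] ℝ)
        (fun q : G => TangentSpace 𝓘(ℝ, E) q →L[ℝ] Trivial G ℝ q) l.proj
    refine closure_mono ?_ (hι.range_subset_closure_image_dense hD ⟨l.snd, rfl⟩)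
    rintro _ ⟨ξ, ⟨⟨hξ0, hξ1⟩, hξz⟩, rfl⟩
    refine ⟨⟨hξ0, hξ1⟩, ?_⟩
    have := hzξ (ξ.comp T) hξz
    rw [hb] at this
    exact this

/-- A left coordinate of a right-invariant field that is not changed by the adjoint action has the
same value everywhere as at the identity. -/
theorem apply_rightCoord_eq_neg [ConnectedSpace G] {ξ : E →L[ℝ] ℝ}
    {v : GroupLieAlgebra 𝓘(ℝ, E) G}
    (h : ∀ (u : GroupLieAlgebra 𝓘(ℝ, E) G) (q : G), ξ (rightCoord ⁅u, v⁆ q) = 0) (q : G) :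
    ξ (rightCoord v q) = -ξ v := by
  refine (eq_of_diffAt_eq_zero (contMDiff_apply_rightCoord ξ v) (fun q w => ?_) q 1).trans
    ((congrArg ξ (rightCoord_one v)).trans (map_neg ξ _))
  obtain ⟨u, rfl⟩ := rightField_surjective q w
  exact (diffAt_apply_rightCoord ξ u v q).trans (h u q)

end

/-! ### Integrals in involution and Liouville integrability -/

section

variable {E : Type*} [NormedAddCommGroup E] [NormedSpace ℝ E]
  {G : Type*} [TopologicalSpace G] [ChartedSpace E G] [Group G] [LieGroup 𝓘(ℝ, E) ∞ G]
  {f : Fin 3 → GroupLieAlgebra 𝓘(ℝ, E) G} {χ κ : ℝ}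

/-- If the Casimir function has rank at least two, any nonzero right-invariant field leaves some
minor of coordinates `k`, `m` not identically zero. -/
theorem exists_coord_rightCoord_ne_zero {b : Module.Basis (Fin 3) ℝ E}
    (hb : ⇑b = (f : Fin 3 → E)) (h : χ ≠ 0 ∨ κ ≠ 0) {α : Fin 3 → ℝ} (hα : α ≠ 0) (q : G) :
    ∃ k m, k ≠ m ∧ casimirCoeff χ κ k ≠ 0 ∧
      b.coord m (rightCoord (α 0 • f 0 + α 1 • f 1 + α 2 • f 2) q) ≠ 0 := by
  set v : GroupLieAlgebra 𝓘(ℝ, E) G := α 0 • f 0 + α 1 • f 1 + α 2 • f 2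
  have hv : v ≠ 0 := by
    intro hv
    have h1 : ∑ i, α i • b i = 0 := by
      rw [Fin.sum_univ_three, hb]
      exact hv
    exact hα (funext (Fintype.linearIndependent_iff.1 b.linearIndependent α h1))
  have h0 : rightCoord (0 : GroupLieAlgebra 𝓘(ℝ, E) G) q = 0 := map_zero (rightCoordLinear q)
  have hw : (rightCoord v q : E) ≠ 0 := fun hw => hv (rightCoord_injective q (hw.trans h0.symm))
  obtain ⟨m, hm⟩ : ∃ m, b.coord m (rightCoord v q) ≠ 0 := by
    by_contra! hm
    exact hw (b.ext_elem fun i => (hm i).trans (map_zero (b.coord i)).symm)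
  by_cases hm0 : m = 0
  · subst hm0
    by_cases h1 : κ - χ = 0
    · refine ⟨2, 0, by decide, ?_, hm⟩
      have : κ + χ ≠ 0 := by
        rcases h with h | h <;> contrapose! h <;> linarith
      simpa [casimirCoeff] using this
    · exact ⟨1, 0, by decide, by simpa [casimirCoeff] using h1, hm⟩
  -- The coefficient of index `0` is `2`, so `k = 0` serves whenever `m ≠ 0`.
  · exact ⟨0, m, fun h => hm0 h.symm, by simp [casimirCoeff], hm⟩

variable [FiniteDimensional ℝ E]

/-- In the Heisenberg case `χ = κ = 0` the Casimir function is `2 ξ₀²` and `f 0` is central, so a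
field with a component outside the centre is needed; its components along `f 1` and `f 2` are
constant. -/
theorem IsUnimodularFrame.exists_coord_rightCoord_ne_zero_of_zero [ConnectedSpace G]
    (hf : IsUnimodularFrame f 0 0) {b : Module.Basis (Fin 3) ℝ E} (hb : ⇑b = (f : Fin 3 → E))
    {α : Fin 3 → ℝ} (hα : α 1 ^ 2 + α 2 ^ 2 ≠ 0) (q : G) :
    ∃ k m, k ≠ m ∧ casimirCoeff 0 0 k ≠ 0 ∧
      b.coord m (rightCoord (α 0 • f 0 + α 1 • f 1 + α 2 • f 2) q) ≠ 0 := by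
  set v : GroupLieAlgebra 𝓘(ℝ, E) G := α 0 • f 0 + α 1 • f 1 + α 2 • f 2 with hv
  have hz : ∀ q : G, rightCoord (0 : GroupLieAlgebra 𝓘(ℝ, E) G) q = 0 :=
    fun q => map_zero (rightCoordLinear q)
  -- `f 0` is central, and all brackets are multiples of it.
  have hu0 : ∀ u : GroupLieAlgebra 𝓘(ℝ, E) G, ⁅u, f 0⁆ = 0 := by
    intro u
    obtain ⟨r, rfl⟩ := hf.exists_eq u
    simp [add_bracket, smul_bracket, bracket_self, hf.bracket_one_zero, hf.bracket_two_zero]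
  have huv : ∀ u : GroupLieAlgebra 𝓘(ℝ, E) G, ∃ r : ℝ, ⁅u, v⁆ = r • f 0 := by
    intro u
    obtain ⟨r, rfl⟩ := hf.exists_eq u
    refine ⟨r 2 * α 1 - r 1 * α 2, ?_⟩
    simp only [hv, bracket_add, bracket_smul, hu0, add_bracket, smul_bracket, bracket_self,
      ← bracket_skew (f 0) (f 1), ← bracket_skew (f 0) (f 2), ← bracket_skew (f 1) (f 2),
      hf.bracket_two_one]
    module
  have hcoord : ∀ m, m ≠ 0 → b.coord m (rightCoord v q) = -α m := by
    intro m hm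
    let ξ : E →L[ℝ] ℝ := (b.coord m).toContinuousLinearMap
    have hξ : ∀ i, ξ (f i) = if i = m then 1 else 0 := by
      intro i
      have : ξ (b i) = if i = m then 1 else 0 := by simp [ξ, Finsupp.single_apply]
      rwa [hb] at this
    have h0 : ∀ q : G, ξ (rightCoord (f 0) q) = 0 := by
      intro q
      refine (apply_rightCoord_eq_neg (fun u q => ?_) q).trans ?_
      · rw [hu0, hz]
        exact map_zero ξ
      · rw [hξ, if_neg hm.symm, neg_zero]
    refine (apply_rightCoord_eq_neg (ξ := ξ) (v := v) (fun u q => ?_) q).trans ?_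
    · obtain ⟨r, hr⟩ := huv u
      rw [hr, rightCoord_smul]
      exact (map_smul ξ r _).trans (by rw [h0, smul_zero])
    · have h1 : ξ v = α 0 * ξ (f 0) + α 1 * ξ (f 1) + α 2 * ξ (f 2) := by
        have h2 : ∀ F : Fin 3 → E, ξ (α 0 • F 0 + α 1 • F 1 + α 2 • F 2) =
          α 0 * ξ (F 0) + α 1 * ξ (F 1) + α 2 * ξ (F 2) := fun F => by simp
        exact h2 f
      rw [h1, hξ, hξ, hξ]
      fin_cases m <;> simp at hm ⊢
  by_cases h1 : α 1 = 0
  · exact ⟨0, 2, by decide, by simp [casimirCoeff], by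
      rw [hcoord 2 (by decide)]; simpa [h1] using hα⟩
  · exact ⟨0, 1, by decide, by simp [casimirCoeff], by
      rw [hcoord 1 (by decide)]; simpa using h1⟩

theorem poisson_quadHam_leftHam_rightHam (c : Fin 3 → ℝ) (v : GroupLieAlgebra 𝓘(ℝ, E) G)
    (l : Cotangent E G) : poisson (quadHam c fun i => leftHam (f i)) (rightHam v) l = 0 := by
  rw [poisson_quadHam_left _ fun i => contMDiff_leftHam (f i)]
  simp only [poisson_leftHam_rightHam, mul_zero, Finset.sum_const_zero]

theorem IsUnimodularFrame.poisson_casimir_leftHam (hf : IsUnimodularFrame f χ κ)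
    (v : GroupLieAlgebra 𝓘(ℝ, E) G) (l : Cotangent E G) :
    poisson (quadHam (casimirCoeff χ κ) fun i => leftHam (f i)) (leftHam v) l = 0 := by
  rw [poisson_quadHam_left _ fun i => contMDiff_leftHam (f i)]
  simp only [poisson_leftHam_leftHam]
  exact hf.sum_casimirCoeff_mul (toLin (leftFunctional l)) v

/-- `E` is the Casimir function minus a multiple of `H`, and `H` commutes with both. -/
theorem IsUnimodularFrame.poisson_geodesicHam_pendulumEnergy (hf : IsUnimodularFrame f χ κ)
    (l : Cotangent E G) : poisson (geodesicHam f) (pendulumEnergy χ f) l = 0 := by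
  have hl := fun i => contMDiff_leftHam (f i)
  have hC : poisson (geodesicHam f) (quadHam (casimirCoeff χ κ) fun i => leftHam (f i)) l = 0 := by
    rw [geodesicHam_eq_quadHam, poisson_quadHam_left _ hl]
    refine Finset.sum_eq_zero fun i _ => ?_
    rw [poisson_swap, hf.poisson_casimir_leftHam, neg_zero, mul_zero]
  have hH := poisson_self (geodesicHam f) l
  rw [poisson_quadHam_right _ hl] at hC
  nth_rw 2 [geodesicHam_eq_quadHam] at hH
  rw [poisson_quadHam_right _ hl] at hH
  rw [pendulumEnergy_eq_quadHam, poisson_quadHam_right _ hl]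
  simp only [Fin.sum_univ_three, casimirCoeff, Matrix.cons_val] at hC hH ⊢
  linear_combination hC - 4 * κ * hH

/-- The relation `4κ dH + dE = 4 (g₀ dg₀ + (κ - χ) g₁ dg₁ + (κ + χ) g₂ dg₂)` is nontrivial since the
coefficient of `dE` is `1`. -/
theorem IsUnimodularFrame.functionallyDependent [ConnectedSpace G]
    (hf : IsUnimodularFrame f χ κ) : FunctionallyDependent (cotangentModel E)
      ![geodesicHam f, pendulumEnergy χ f, rightHam (f 0), rightHam (f 1), rightHam (f 2)] := by
  intro l h
  have hl := fun i => contMDiff_leftHam (f i)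
  have hr := fun i => contMDiff_rightHam (f i)
  have h1 := Fintype.linearIndependent_iff.1 h ![4 * κ, 1, -4 * rightHam (f 0) l,
    -4 * (κ - χ) * rightHam (f 1) l, -4 * (κ + χ) * rightHam (f 2) l] ?_ 1
  · simp at h1
  · have h2 : ∀ w : TangentSpace (cotangentModel E) l,
        4 * κ * diffAt (cotangentModel E) (geodesicHam f) l w +
        1 * diffAt (cotangentModel E) (pendulumEnergy χ f) l w +
        -4 * rightHam (f 0) l * diffAt (cotangentModel E) (rightHam (f 0)) l w +
        -4 * (κ - χ) * rightHam (f 1) l * diffAt (cotangentModel E) (rightHam (f 1)) l w +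
        -4 * (κ + χ) * rightHam (f 2) l * diffAt (cotangentModel E) (rightHam (f 2)) l w = 0 := by
      intro w
      have h3 := diffAt_quadHam (casimirCoeff χ κ) hl l w
      have h4 := diffAt_quadHam (casimirCoeff χ κ) hr l w
      rw [hf.quadHam_leftHam_eq, h4] at h3
      rw [geodesicHam_eq_quadHam, pendulumEnergy_eq_quadHam, diffAt_quadHam _ hl,
        diffAt_quadHam _ hl]
      simp only [Fin.sum_univ_three, casimirCoeff, Matrix.cons_val] at h3 ⊢
      linear_combination -h3
    rw [Fin.sum_univ_five]
    exact ContinuousLinearMap.ext h2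

theorem IsUnimodularFrame.inInvolution (hf : IsUnimodularFrame f χ κ)
    (v : GroupLieAlgebra 𝓘(ℝ, E) G) :
    InInvolution ![geodesicHam f, pendulumEnergy χ f, rightHam v] := by
  have hH : ∀ l, poisson (geodesicHam f) (rightHam v) l = 0 := fun l => by
    rw [geodesicHam_eq_quadHam, poisson_quadHam_leftHam_rightHam]
  have hP : ∀ l, poisson (pendulumEnergy χ f) (rightHam v) l = 0 := fun l => by
    rw [pendulumEnergy_eq_quadHam, poisson_quadHam_leftHam_rightHam]
  have hHP := hf.poisson_geodesicHam_pendulumEnergy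
  intro i j l
  fin_cases i <;> fin_cases j
  · exact poisson_self _ l
  · exact hHP l
  · exact hH l
  · exact (poisson_swap _ _ l).trans (neg_eq_zero.2 (hHP l))
  · exact poisson_self _ l
  · exact hP l
  · exact (poisson_swap _ _ l).trans (neg_eq_zero.2 (hH l))
  · exact (poisson_swap _ _ l).trans (neg_eq_zero.2 (hP l))
  · exact poisson_self _ l

theorem IsUnimodularFrame.functionallyIndependent_rightCombination [ConnectedSpace G]
    (hf : IsUnimodularFrame f χ κ) (hE : Module.finrank ℝ E = 3) {α : Fin 3 → ℝ}
    (hα : α ≠ 0) (h : χ ≠ 0 ∨ α 1 ^ 2 + α 2 ^ 2 ≠ 0) :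
    FunctionallyIndependent (cotangentModel E)
      ![geodesicHam f, pendulumEnergy χ f, rightCombination α f] := by
  obtain ⟨b, hb⟩ := hf.exists_basis hE
  rw [rightCombination_eq_rightHam]
  refine hf.functionallyIndependent hb _ fun q => ?_
  by_cases hχκ : χ ≠ 0 ∨ κ ≠ 0
  · exact exists_coord_rightCoord_ne_zero hb hχκ hα q
  · push Not at hχκ
    obtain ⟨rfl, rfl⟩ := hχκ
    exact hf.exists_coord_rightCoord_ne_zero_of_zero hb (by simpa using h) q

theorem IsUnimodularFrame.liouvilleIntegrable [ConnectedSpace G]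
    (hf : IsUnimodularFrame f χ κ) (hE : Module.finrank ℝ E = 3) :
    LiouvilleIntegrable (geodesicHam f) := by
  have h : FunctionallyIndependent (cotangentModel E)
      ![geodesicHam f, pendulumEnergy χ f, rightCombination ![0, 1, 0] f] :=
    hf.functionallyIndependent_rightCombination hE
      (fun h => by simpa using congrFun h 1) (Or.inr (by simp))
  have h2 : InInvolution ![geodesicHam f, pendulumEnergy χ f, rightCombination ![0, 1, 0] f] :=
    rightCombination_eq_rightHam ![0, 1, 0] f ▸ hf.inInvolution _
  have hs : ∀ k, ContMDiff (cotangentModel E) 𝓘(ℝ, ℝ) ∞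
      (![geodesicHam f, pendulumEnergy χ f, rightCombination ![0, 1, 0] f] k) := by
    intro k
    fin_cases k
    · exact contMDiff_geodesicHam (f := f)
    · exact contMDiff_pendulumEnergy (f := f)
    · exact (rightCombination_eq_rightHam ![0, 1, 0] f).symm ▸
        contMDiff_rightHam (E := E) (G := G) _
  refine ⟨fun i => ![geodesicHam f, pendulumEnergy χ f, rightCombination ![0, 1, 0] f]
    (Fin.cast hE i), ⟨Fin.cast hE.symm 0, rfl, rfl⟩, fun i => hs _, fun i j => h2 _ _, ?_⟩
  · obtain ⟨U, hU, hUd, hUi⟩ := h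
    exact ⟨U, hU, hUd, fun x hx => (hUi x hx).comp (Fin.cast hE) (Fin.cast_injective hE)⟩

end

end SubRiem

theorem theorem1
    {E : Type*} [NormedAddCommGroup E] [NormedSpace ℝ E] [FiniteDimensional ℝ E]
    (hE : Module.finrank ℝ E = 3)
    {G : Type*} [TopologicalSpace G] [ChartedSpace E G] [Group G] [LieGroup 𝓘(ℝ, E) ∞ G]
    [ConnectedSpace G]
    (S : ContactSR E G) (f : Fin 3 → GroupLieAlgebra 𝓘(ℝ, E) G) (χ κ : ℝ)
    (hframe : S.IsOrthonormalFrame (f 1) (f 2))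
    (h21 : ⁅f 2, f 1⁆ = f 0)
    (h10 : ⁅f 1, f 0⁆ = (χ + κ) • f 2)
    (h20 : ⁅f 2, f 0⁆ = (χ - κ) • f 1) :
    -- Hamiltonian vector fields on the cotangent bundle are well defined
    (∀ (a : Cotangent E G → ℝ) (l : Cotangent E G), ∃! v, IsHamiltonianVector a l v) ∧
    -- (1) the integrals and their Poisson brackets
    (IsFirstIntegral (cotangentModel E) (hamiltonianField (geodesicHam f)) (geodesicHam f) ∧
      IsFirstIntegral (cotangentModel E) (hamiltonianField (geodesicHam f)) (pendulumEnergy χ f) ∧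
      (∀ i, IsFirstIntegral (cotangentModel E) (hamiltonianField (geodesicHam f)) (rightHam (f i))) ∧
      (∀ l, poisson (geodesicHam f) (pendulumEnergy χ f) l = 0) ∧
      (∀ i l, poisson (geodesicHam f) (rightHam (f i)) l = 0) ∧
      (∀ i l, poisson (pendulumEnergy χ f) (rightHam (f i)) l = 0) ∧
      (∀ l, poisson (rightHam (f 2)) (rightHam (f 1)) l = rightHam (f 0) l) ∧
      (∀ l, poisson (rightHam (f 1)) (rightHam (f 0)) l = (χ + κ) * rightHam (f 2) l) ∧
      (∀ l, poisson (rightHam (f 2)) (rightHam (f 0)) l = (χ - κ) * rightHam (f 1) l)) ∧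
    -- (2) functional dependence, the identity, and the Casimir property of its two sides
    (FunctionallyDependent (cotangentModel E)
        ![geodesicHam f, pendulumEnergy χ f, rightHam (f 0), rightHam (f 1), rightHam (f 2)] ∧
      (∀ l, 4 * κ * geodesicHam f l + pendulumEnergy χ f l =
        2 * (rightHam (f 0) l ^ 2 + (κ - χ) * rightHam (f 1) l ^ 2
          + (κ + χ) * rightHam (f 2) l ^ 2)) ∧
      IsCasimir G (fun ξ : E →L[ℝ] ℝ =>
        4 * κ * ((ξ (f 1) ^ 2 + ξ (f 2) ^ 2) / 2) +
          (2 * ξ (f 0) ^ 2 - 2 * χ * (ξ (f 1) ^ 2 - ξ (f 2) ^ 2))) ∧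
      IsCasimir G (fun ξ : E →L[ℝ] ℝ =>
        2 * (ξ (f 0) ^ 2 + (κ - χ) * ξ (f 1) ^ 2 + (κ + χ) * ξ (f 2) ^ 2)) ∧
      (∀ i l, poisson (casimirLeft χ κ f) (leftHam (f i)) l = 0 ∧
        poisson (casimirLeft χ κ f) (rightHam (f i)) l = 0 ∧
        poisson (casimirRight χ κ f) (leftHam (f i)) l = 0 ∧
        poisson (casimirRight χ κ f) (rightHam (f i)) l = 0)) ∧
    -- (3) Liouville integrability
    (LiouvilleIntegrable (geodesicHam f) ∧
      (χ ≠ 0 → ∀ α : Fin 3 → ℝ, α ≠ 0 →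
        InInvolution ![geodesicHam f, pendulumEnergy χ f, rightCombination α f] ∧
        FunctionallyIndependent (cotangentModel E)
          ![geodesicHam f, pendulumEnergy χ f, rightCombination α f]) ∧
      (χ = 0 → ∀ α : Fin 3 → ℝ, α 1 ^ 2 + α 2 ^ 2 ≠ 0 →
        InInvolution ![geodesicHam f, pendulumEnergy χ f, rightCombination α f] ∧
        FunctionallyIndependent (cotangentModel E)
          ![geodesicHam f, pendulumEnergy χ f, rightCombination α f])) := by
  have hf : IsUnimodularFrame f χ κ := ⟨S.span_frame_eq_top f hframe.1 h21, h21, h10, h20⟩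
  have hHP := hf.poisson_geodesicHam_pendulumEnergy
  have hHg : ∀ i l, poisson (geodesicHam f) (rightHam (f i)) l = 0 := fun i l => by
    rw [geodesicHam_eq_quadHam, poisson_quadHam_leftHam_rightHam]
  have hPg : ∀ i l, poisson (pendulumEnergy χ f) (rightHam (f i)) l = 0 := fun i l => by
    rw [pendulumEnergy_eq_quadHam, poisson_quadHam_leftHam_rightHam]
  have hC : (casimirLeft χ κ f : Cotangent E G → ℝ) = casimirRight χ κ f := by
    rw [casimirLeft_eq_quadHam, casimirRight_eq_quadHam, hf.quadHam_leftHam_eq]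
  have hL : ∀ i l, poisson (casimirLeft χ κ f) (leftHam (f i)) l = 0 := fun i l => by
    rw [casimirLeft_eq_quadHam, hf.poisson_casimir_leftHam]
  have hR : ∀ i l, poisson (casimirLeft χ κ f) (rightHam (f i)) l = 0 := fun i l => by
    rw [casimirLeft_eq_quadHam, poisson_quadHam_leftHam_rightHam]
  have hinv : ∀ α : Fin 3 → ℝ, InInvolution ![geodesicHam f, pendulumEnergy χ f,
      (rightCombination α f : Cotangent E G → ℝ)] := fun α => by
    rw [rightCombination_eq_rightHam]
    exact hf.inInvolution _
  refine ⟨existsUnique_isHamiltonianVector,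
    ⟨isFirstIntegral_hamiltonianField contMDiff_geodesicHam (poisson_self _),
      isFirstIntegral_hamiltonianField contMDiff_pendulumEnergy hHP,
      fun i => isFirstIntegral_hamiltonianField (contMDiff_rightHam (f i)) (hHg i),
      hHP, hHg, hPg, fun l => ?_, fun l => ?_, fun l => ?_⟩,
    ⟨hf.functionallyDependent, congrFun hC, ?_, ?_, fun i l =>
      ⟨hL i l, hR i l, hC ▸ hL i l, hC ▸ hR i l⟩⟩,
    hf.liouvilleIntegrable hE, fun hχ α hα => ⟨hinv α,
      hf.functionallyIndependent_rightCombination hE hα (Or.inl hχ)⟩,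
    fun _ α hα => ⟨hinv α, hf.functionallyIndependent_rightCombination hE (fun h => ?_)
      (Or.inr hα)⟩⟩
  · rw [poisson_rightHam_rightHam, h21]
  · rw [poisson_rightHam_rightHam, h10, rightHam_smul]
  · rw [poisson_rightHam_rightHam, h20, rightHam_smul]
  · convert! hf.isCasimir using 2 with ξ
    simp only [Fin.sum_univ_three, casimirCoeff, Matrix.cons_val]
    ring
  · convert! hf.isCasimir using 2 with ξ
    simp only [Fin.sum_univ_three, casimirCoeff, Matrix.cons_val]
    ring
  · simp [h] at hα
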